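/- Let $d\ge 1$ and let $\Omega\subset\mathbb R^d$ be a domain (a non-empty, open, bounded and connected set) with $C^1$ boundary: near each point of $\partial\Omega$, the set $\Omega$ is, in suitable orthonormal coordinates, the region below the graph of a $C^1$ function. Let $\nu$ be the outward unit normal to $\partial\Omega$. **The constant $\overline c_f$.** For $x,y\in\overline\Omega$ let $d(x,y)$ be the infimum of the lengths of rectifiable paths from $x$ to $y$ in $\overline\Omega$. For $\epsilon>0$ consider the following tug-of-war game on the graph with vertex set $\overline\Omega$ in which $x\sim y$ if and only if $d(x,y)\le\epsilon$ (so every vertex has a loop), for bounded $f,g:\overline\Omega\to\mathbb R$. A token starts at a vertex. At each of $n$ steps, Player II pays $f(x)$ to Player I, where $x$ is the current position of the token; then a fair coin is tossed and the winner of the toss moves the token to a neighbour of $x$ of his choice. After $n$ steps Player II pays $g(y)$ to Player I, where $y$ is the final position. The players' strategies may depend on all previous positions and coin tosses. Let $u_n(x)=\sup_{\mathcal S_{\mathrm I}}\inf_{\mathcal S_{\mathrm{II}}}(\text{expected total payoff})$ be the value of this game started at $x$. There is a unique constant $c_f(\epsilon)$ such that, for every bounded $g$, the functions $u_n-n\,c_f(\epsilon)$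 are bounded uniformly in $n$. Put $\overline c_f=\lim_{\epsilon\downarrow0}c_f(\epsilon)$. **Viscosity solutions.** For a smooth $\varphi$ put $\Delta_\infty^+\varphi(x)=|\nabla\varphi(x)|^{-2}\sum_{i,j}\varphi_{x_i}(x)\varphi_{x_ix_j}(x)\varphi_{x_j}(x)$ if $\nabla\varphi(x)\ne0$, and $\Delta_\infty^+\varphi(x)=\max_{|v|=1}\sum_{i,j}\varphi_{x_ix_j}(x)v_iv_j$ if $\nabla\varphi(x)=0$. A continuous $u:\overline\Omega\to\mathbb R$ is a viscosity subsolution of $$-\Delta_\infty u=f\ \text{ in }\Omega,\qquad \nabla_\nu u=0\ \text{ on }\partial\Omega \tag{$*$}$$ if, whenever $\varphi$ is $C^\infty$ on an open set containing $\overline\Omega$ and $u-\varphi$ has a strict local maximum (relative to $\overline\Omega$) at $x_0\in\overline\Omega$, either $-\Delta_\infty^+\varphi(x_0)\le f(x_0)$, or $x_0\in\partial\Omega$ and $\nabla_{\nu(x_0)}\varphi(x_0)\le0$. It is a supersolution if $-u$ is a subsolution of $(*)$ with $f$ replaced by $-f$, and a solution if it is both a subsolution and a supersolution. **Theorem.**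 There is a function $L:\mathbb R\to[0,\infty)$, depending only on $\Omega$, such that for every continuous $f:\overline\Omega\to\mathbb R$ with $\overline c_f=0$ the problem $(*)$ has a viscosity solution $u:\overline\Omega\to\mathbb R$ which satisfies $|u(x)-u(y)|\le L(\|f\|)\,|x-y|$ for all $x,y\in\overline\Omega$, where $\|f\|=\max_{\overline\Omega}|f|$. -/

import Mathlib

open Set Filter Topology
open scoped NNReal ENNReal ContDiff RealInnerProductSpace Gradient

noncomputable section

namespace TugOfWar

/-! ### The tug-of-war game of finite horizon on a graph

A graph is given by its adjacency relation (loops and infinite degrees are allowed). -/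

/-- A strategy of a player. Before a step, the player knows the current position of the token and
the history of the play: for every earlier step, most recent first, the position from which the
token was moved and the result of the coin toss (`true` if Player I won it). The strategy names
the neighbour of the current position to which the player moves the token on winning the toss. -/
structure Strategy {V : Type*} (adj : V → V → Prop) where
  /-- the chosen neighbour, as a function of the history and of the current position -/
  move : List (V × Bool) → V → V
  /-- the token is always moved along an edge -/
  adj_move : ∀ h x, adj x (move h x)

/-- The expected payoff (from Player II to Player I) of the remaining `n` steps when the token is
at `x` after the history `h`, with running payoff `f` and terminal payoff `g`. Player I plays `S`,
Player II plays `T`. At each step `f x` is paid and a fair coin decides who moves the token; at the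
end `g` of the final position is paid. -/
def expectedPayoff {V : Type*} {adj : V → V → Prop} (f g : V → ℝ) (S T : Strategy adj) :
    ℕ → List (V × Bool) → V → ℝ
  | 0, _, x => g x
  | n + 1, h, x =>
      f x + (expectedPayoff f g S T n ((x, true) :: h) (S.move h x)
        + expectedPayoff f g S T n ((x, false) :: h) (T.move h x)) / 2

/-- The value of the game of horizon `n` started at `x`: the supremum over Player I's strategies
of the infimum over Player II's strategies of the expected payoff. (For bounded payoffs on a graph
without isolated vertices, the infimum of the suprema is the same number.) -/
def gameValue {V : Type*} (adj : V → V → Prop) (f g : V → ℝ) (n : ℕ) (x : V) : ℝ :=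
  ⨆ S : Strategy adj, ⨅ T : Strategy adj, expectedPayoff f g S T n [] x

/-- `c` is Player I's long term advantage for the running payoff `f`: for every bounded terminal
payoff `g`, the functions `u_n - n c` are bounded uniformly in `n`, where `u_n` is the value of the
game of horizon `n`. -/
def IsLongTermAdvantage {V : Type*} (adj : V → V → Prop) (f : V → ℝ) (c : ℝ) : Prop :=
  ∀ g : V → ℝ, (∃ M : ℝ, ∀ x, |g x| ≤ M) →
    ∃ C : ℝ, ∀ (n : ℕ) (x : V), |gameValue adj f g n x - n * c| ≤ C

/-- Player I's long term advantage `c_f`. On a non-empty connected graph of finite diameter, with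
`f` bounded, there is exactly one `c` with `IsLongTermAdvantage adj f c`, and this is it. -/
def longTermAdvantage {V : Type*} (adj : V → V → Prop) (f : V → ℝ) : ℝ :=
  Classical.epsilon (IsLongTermAdvantage adj f)

/-! ### Adjacency graphs -/

/-- The intrinsic (path) distance: the infimum of the lengths of the paths from `x` to `y` in the
space. For a subset of Euclidean space, viewed as a subtype, these are the paths that stay in the
subset, with their Euclidean lengths. Paths of infinite length do not affect the infimum. -/
def intrinsicEDist {X : Type*} [MetricSpace X] (x y : X) : ℝ≥0∞ :=
  ⨅ p : Path x y, eVariationOn p Set.univ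

/-- Adjacency in the `ε`-adjacency graph of a space with its intrinsic distance. -/
def epsAdj (X : Type*) [MetricSpace X] (ε : ℝ) (x y : X) : Prop :=
  intrinsicEDist x y ≤ ENNReal.ofReal ε

/-- `a` is the long term advantage of `f` in the limit of small step sizes: with `c_f(ε)` the long
term advantage on the `ε`-adjacency graph, `a` is the limit of `c_f(ε)` as `ε` decreases to `0`. -/
def IsLimitAdvantage {X : Type*} [MetricSpace X] (f : X → ℝ) (a : ℝ) : Prop :=
  Tendsto (fun ε : ℝ => longTermAdvantage (epsAdj X ε) f) (𝓝[>] 0) (𝓝 a)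

/-! ### Domains with `C^1` boundary -/

/-- `d`-dimensional Euclidean space. -/
abbrev E (d : ℕ) : Type := EuclideanSpace ℝ (Fin d)

variable {d : ℕ}

/-- The function `y ↦ ⟪e, y⟫ - γ (P y)`, where `P` is the orthogonal projection along the unit
vector `e`. It is negative below the graph, over the hyperplane orthogonal to `e`, of the
restriction of `γ` to this hyperplane, and positive above the graph. -/
def graphFun (e : E d) (γ : E d → ℝ) (y : E d) : ℝ :=
  ⟪e, y⟫ - γ (y - ⟪e, y⟫ • e)

/-- In the ball of centre `x` and radius `r`, the set `Ω` is the region below the graph of the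
`C^1` function `γ`, in an orthonormal coordinate system whose last axis is `e`. -/
def IsGraphChart (Ω : Set (E d)) (x e : E d) (r : ℝ) (γ : E d → ℝ) : Prop :=
  ‖e‖ = 1 ∧ 0 < r ∧ ContDiff ℝ 1 γ ∧ ∀ y ∈ Metric.ball x r, (y ∈ Ω ↔ graphFun e γ y < 0)

/-- The boundary of `Ω` is `C^1`: near each of its points, `Ω` is, in suitable orthonormal
coordinates, the region below the graph of a `C^1` function. -/
def HasC1Boundary (Ω : Set (E d)) : Prop :=
  ∀ x ∈ frontier Ω, ∃ (e : E d) (r : ℝ) (γ : E d → ℝ), IsGraphChart Ω x e r γ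

/-- `ν` is the outward unit normal vector to the boundary of `Ω` at `x`: the normalized gradient
of the function that defines `Ω` near `x`. It does not depend on the chart. -/
def IsOuterNormal (Ω : Set (E d)) (x ν : E d) : Prop :=
  ∃ (e : E d) (r : ℝ) (γ : E d → ℝ), IsGraphChart Ω x e r γ ∧
    ν = ‖∇ (graphFun e γ) x‖⁻¹ • ∇ (graphFun e γ) x

/-! ### The infinity Laplacian and viscosity solutions -/

/-- The second derivative `∑ φ_{x_i x_j}(x) v_i v_j`. -/
def hess (φ : E d → ℝ) (x v : E d) : ℝ := fderiv ℝ (fderiv ℝ φ) x v v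

open Classical in
/-- The upper infinity Laplacian: the second derivative in the direction of the gradient where the
gradient does not vanish, and otherwise the largest second derivative in a unit direction. -/
def upperInfLaplacian (φ : E d → ℝ) (x : E d) : ℝ :=
  if ∇ φ x ≠ 0 then ‖∇ φ x‖⁻¹ ^ 2 * hess φ x (∇ φ x)
  else sSup (hess φ x '' {v : E d | ‖v‖ = 1})

/-- Viscosity subsolutions of `-Δ_∞ u = f` in `Ω`, `∇_ν u = 0` on the boundary of `Ω`. The test
functions are smooth on an open set that contains the closure of `Ω`, and local maxima are relative
to this closure. -/
def IsViscositySubsolution (Ω : Set (E d)) (f u : closure Ω → ℝ) : Prop :=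
  Continuous u ∧
  ∀ (U : Set (E d)) (φ : E d → ℝ), IsOpen U → closure Ω ⊆ U → ContDiffOn ℝ ∞ φ U →
    ∀ x₀ : closure Ω, (∀ᶠ y in 𝓝[≠] x₀, u y - φ y < u x₀ - φ x₀) →
      -upperInfLaplacian φ x₀ ≤ f x₀ ∨
      ((x₀ : E d) ∈ frontier Ω ∧ ∃ ν : E d, IsOuterNormal Ω x₀ ν ∧ ⟪∇ φ (x₀ : E d), ν⟫ ≤ 0)

/-- Viscosity supersolutions: `-u` is a subsolution for `-f`. -/
def IsViscositySupersolution (Ω : Set (E d)) (f u : closure Ω → ℝ) : Prop :=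
  IsViscositySubsolution Ω (fun x => -f x) (fun x => -u x)

/-- Viscosity solutions of `-Δ_∞ u = f` in `Ω`, `∇_ν u = 0` on the boundary of `Ω`. -/
def IsViscositySolution (Ω : Set (E d)) (f u : closure Ω → ℝ) : Prop :=
  IsViscositySubsolution Ω f u ∧ IsViscositySupersolution Ω f u

end TugOfWar

end

/-! Fix the step size ε. By dynamic programming the value of the game of horizon n is the n-th
iterate, applied to g, of u ↦ f + (sup u + inf u)/2 over neighbours (`gameValue_eq_iterate`). This
operator is nonexpansive for the sup norm and commutes with adding constants. Discounting produces
functions that it shifts by almost a constant (`exists_approx_eigenfunction`), and iterating on them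
identifies that constant with c_f(ε) (`exists_approx_solution`).

The quantitative heart is `abs_sub_le_of_abs_sub_midrange_le`. If u is within H of its midrange, a
steepest ascent that starts with a nearly maximal increment S loses only about 2H of increment per
step. Continued for about twice the graph diameter k, it would climb more than the total oscillation
kS, unless S = O(kH). The C^1 boundary gives k = O(1/ε) (`exists_stepBound`), so w = ε²u/2 changes
by O(ε) along edges: it is Lipschitz above the scale ε, with a constant depending only on Ω and ‖f‖.
Compactness (`exists_uniform_limit`) gives a Lipschitz limit, and c_f(ε) → 0 leaves w - midrange w =
ε²f/2 + o(ε²) (`exists_isGameLimit`).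

Let φ touch the limit from above at x₀. Then w - φ is almost maximal at some x near x₀, and the
equation for w yields φ(y) + φ(z) - 2φ(x) ≥ -ε²(f(x₀) + o(1)) for one nearly best neighbour y and
every neighbour z (`IsGameLimit.exists_touching`). If ∇φ(x₀) ≠ 0, take for z the step of length ε
against the gradient: the first-order terms at worst cancel, and Taylor expansion gives the
inequality (`IsGameLimit.neg_hess_le`). Only this one move has to be available, so the argument also
works at a boundary point where the gradient has a positive outward component. If the gradient
vanishes in the interior and the largest Hessian eigenvalue is non-negative, z is the reflection of
y in x; if it is negative, a small linear perturbation moves the touching to a point of non-zero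
gradient. Exchanging the players gives the supersolution half. -/

noncomputable section

namespace TugOfWar

variable {d : ℕ}

/-! ### The averaging operator of a graph -/

section Graph

variable {V : Type*} {adj : V → V → Prop}

/-- The average of the supremum and the infimum of `u` over the neighbours of `x`. -/
def midrange (adj : V → V → Prop) (u : V → ℝ) (x : V) : ℝ :=
  ((⨆ y : {y // adj x y}, u y) + ⨅ y : {y // adj x y}, u y) / 2

/-- One step of dynamic programming for the running payoff `f`. -/
def gameStep (adj : V → V → Prop) (f u : V → ℝ) (x : V) : ℝ :=
  f x + midrange adj u x

lemma bddAbove_range_of_abs_le {ι : Sort*} {u : ι → ℝ} {B : ℝ} (h : ∀ x, |u x| ≤ B) :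
    BddAbove (range u) :=
  ⟨B, by rintro _ ⟨x, rfl⟩; exact (abs_le.1 (h x)).2⟩

lemma bddBelow_range_of_abs_le {ι : Sort*} {u : ι → ℝ} {B : ℝ} (h : ∀ x, |u x| ≤ B) :
    BddBelow (range u) :=
  ⟨-B, by rintro _ ⟨x, rfl⟩; exact (abs_le.1 (h x)).1⟩

lemma le_iSup_adj {u : V → ℝ} {B : ℝ} (hu : ∀ x, |u x| ≤ B) {x y : V} (h : adj x y) :
    u y ≤ ⨆ y : {y // adj x y}, u y :=
  le_ciSup (f := fun y : {y // adj x y} => u y)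
    (bddAbove_range_of_abs_le (fun y => hu y)) ⟨y, h⟩

lemma iInf_adj_le {u : V → ℝ} {B : ℝ} (hu : ∀ x, |u x| ≤ B) {x y : V} (h : adj x y) :
    (⨅ y : {y // adj x y}, u y) ≤ u y :=
  ciInf_le (f := fun y : {y // adj x y} => u y)
    (bddBelow_range_of_abs_le (fun y => hu y)) ⟨y, h⟩

lemma midrange_le_add (hadj : ∀ x, adj x x) {u v : V → ℝ} {B C c : ℝ} (hu : ∀ x, |u x| ≤ B)
    (hv : ∀ x, |v x| ≤ C) {x : V} (h : ∀ y, adj x y → u y ≤ v y + c) :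
    midrange adj u x ≤ midrange adj v x + c := by
  have : Nonempty {y // adj x y} := ⟨⟨x, hadj x⟩⟩
  have h1 : (⨆ y : {y // adj x y}, u y) ≤ (⨆ y : {y // adj x y}, v y) + c :=
    ciSup_le fun y => (h y y.2).trans (by gcongr; exact le_iSup_adj hv y.2)
  have h2 : (⨅ y : {y // adj x y}, u y) - c ≤ ⨅ y : {y // adj x y}, v y :=
    le_ciInf fun y => by linarith [h y y.2, iInf_adj_le hu y.2]
  unfold midrange
  linarith

lemma midrange_const (hadj : ∀ x, adj x x) (c : ℝ) (x : V) :
    midrange adj (fun _ => c) x = c := by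
  have : Nonempty {y // adj x y} := ⟨⟨x, hadj x⟩⟩
  simp [midrange]

lemma abs_midrange_sub_le (hadj : ∀ x, adj x x) {u v : V → ℝ} {B C c : ℝ} (hu : ∀ x, |u x| ≤ B)
    (hv : ∀ x, |v x| ≤ C) {x : V} (h : ∀ y, adj x y → |u y - v y| ≤ c) :
    |midrange adj u x - midrange adj v x| ≤ c := by
  rw [abs_le]
  constructor
  · linarith [midrange_le_add hadj hv hu (x := x) (c := c)
      fun y hy => by linarith [(abs_le.1 (h y hy)).1]]
  · linarith [midrange_le_add hadj hu hv (x := x) (c := c)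
      fun y hy => by linarith [(abs_le.1 (h y hy)).2]]

lemma abs_midrange_sub_const_le (hadj : ∀ x, adj x x) {u : V → ℝ} {B b c : ℝ}
    (hu : ∀ x, |u x| ≤ B) {x : V} (h : ∀ y, adj x y → |u y - b| ≤ c) :
    |midrange adj u x - b| ≤ c := by
  have := abs_midrange_sub_le hadj hu (v := fun _ => b) (C := |b|) (fun _ => le_rfl) h
  rwa [midrange_const hadj] at this

lemma abs_midrange_le (hadj : ∀ x, adj x x) {u : V → ℝ} {B : ℝ} (hu : ∀ x, |u x| ≤ B) (x : V) :
    |midrange adj u x| ≤ B := by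
  simpa using abs_midrange_sub_const_le hadj hu (x := x) (b := 0) (fun y _ => by simpa using hu y)

/-- Exchanging the players turns subsolutions into supersolutions. No boundedness is needed, because
the infimum of a real set is by definition minus the supremum of its negation, also for unbounded
sets. -/
lemma midrange_neg (u : V → ℝ) (x : V) :
    midrange adj (fun y => -u y) x = -midrange adj u x := by
  unfold midrange
  have h1 : (⨆ y : {y // adj x y}, -u y) = -⨅ y : {y // adj x y}, u y := by
    rw [iInf, Real.sInf_def, neg_neg, iSup]
    congr 1
    ext z
    simp [neg_eq_iff_eq_neg]
  have h2 : (⨅ y : {y // adj x y}, -u y) = -⨆ y : {y // adj x y}, u y := by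
    rw [iInf, Real.sInf_def, iSup]
    congr 2
    ext z
    simp
  rw [h1, h2]
  ring

lemma midrange_mul_sub (hadj : ∀ x, adj x x) {u : V → ℝ} {a : ℝ} (ha : 0 ≤ a) {B : ℝ}
    (hu : ∀ x, |u x| ≤ B) (b : ℝ) (x : V) :
    midrange adj (fun y => a * (u y - b)) x = a * (midrange adj u x - b) := by
  have : Nonempty {y // adj x y} := ⟨⟨x, hadj x⟩⟩
  unfold midrange
  rw [← Real.mul_iSup_of_nonneg ha, ← Real.mul_iInf_of_nonneg ha,
    ← ciSup_sub (f := fun y : {y // adj x y} => u y) (bddAbove_range_of_abs_le (fun y => hu y)),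
    ← ciInf_sub (f := fun y : {y // adj x y} => u y) (bddBelow_range_of_abs_le (fun y => hu y))]
  ring

/-! ### Dynamic programming -/

lemma exists_abs_gameStep_iterate_le (hadj : ∀ x, adj x x) {f g : V → ℝ} {F G : ℝ}
    (hf : ∀ x, |f x| ≤ F) (hg : ∀ x, |g x| ≤ G) (n : ℕ) (x : V) :
    |(gameStep adj f)^[n] g x| ≤ n * F + G := by
  induction n generalizing x with
  | zero => simpa using hg x
  | succ n ih =>
    rw [Function.iterate_succ_apply', gameStep]
    refine (abs_add_le _ _).trans ?_
    push_cast
    linarith [hf x, abs_midrange_le hadj ih x]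

lemma expectedPayoff_le {f g : V → ℝ} {F G : ℝ} (hf : ∀ x, |f x| ≤ F) (hg : ∀ x, |g x| ≤ G)
    (S T : Strategy adj) (n : ℕ) (h : List (V × Bool)) (x : V) :
    |expectedPayoff f g S T n h x| ≤ n * F + G := by
  induction n generalizing h x with
  | zero => simpa [expectedPayoff] using hg x
  | succ n ih =>
    rw [expectedPayoff]
    have h1 := abs_le.1 (ih ((x, true) :: h) (S.move h x))
    have h2 := abs_le.1 (ih ((x, false) :: h) (T.move h x))
    have h3 := abs_le.1 (hf x)
    push_cast
    rw [abs_le]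
    constructor <;> linarith

/-- A strategy for Player I that is optimal up to `η` per step in the game of horizon `n`. -/
lemma exists_strategy_ge (hadj : ∀ x, adj x x) {f g : V → ℝ} {F G : ℝ}
    (hf : ∀ x, |f x| ≤ F) (hg : ∀ x, |g x| ≤ G) {η : ℝ} (hη : 0 < η) (n : ℕ) :
    ∃ S : Strategy adj, ∀ (T : Strategy adj) (m : ℕ) (h : List (V × Bool)) (x : V),
      m + h.length = n → (gameStep adj f)^[m] g x - m * η ≤ expectedPayoff f g S T m h x := by
  have key : ∀ (m : ℕ) (x : V), ∃ y, adj x y ∧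
      (⨆ y : {y // adj x y}, (gameStep adj f)^[m] g y) - η ≤ (gameStep adj f)^[m] g y := by
    intro m x
    have : Nonempty {y // adj x y} := ⟨⟨x, hadj x⟩⟩
    obtain ⟨y, hy⟩ := exists_lt_of_lt_ciSup
      (sub_lt_self (⨆ y : {y // adj x y}, (gameStep adj f)^[m] g y) hη)
    exact ⟨y, y.2, hy.le⟩
  choose mv hmv hval using key
  -- The length of the history serves as the clock: `n - h.length - 1` is the number of steps that
  -- remain after the current move.
  refine ⟨⟨fun h x => mv (n - h.length - 1) x, fun h x => hmv _ x⟩, fun T m => ?_⟩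
  induction m with
  | zero => intro h x _; simp [expectedPayoff]
  | succ m ih =>
    intro h x hm
    have hb := exists_abs_gameStep_iterate_le hadj hf hg m
    have h1 := ih ((x, true) :: h) (mv (n - h.length - 1) x) (by simp; omega)
    have h2 := ih ((x, false) :: h) (T.move h x) (by simp; omega)
    have h3 := hval m x
    have h4 := iInf_adj_le hb (T.adj_move h x)
    have h5 : n - h.length - 1 = m := by omega
    rw [Function.iterate_succ_apply', gameStep, midrange, expectedPayoff]
    simp only [h5] at h1 ⊢
    push_cast
    linarith

/-- A strategy for Player II that is optimal up to `η` per step in the game of horizon `n`. -/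
lemma exists_strategy_le (hadj : ∀ x, adj x x) {f g : V → ℝ} {F G : ℝ}
    (hf : ∀ x, |f x| ≤ F) (hg : ∀ x, |g x| ≤ G) {η : ℝ} (hη : 0 < η) (n : ℕ) :
    ∃ T : Strategy adj, ∀ (S : Strategy adj) (m : ℕ) (h : List (V × Bool)) (x : V),
      m + h.length = n → expectedPayoff f g S T m h x ≤ (gameStep adj f)^[m] g x + m * η := by
  have key : ∀ (m : ℕ) (x : V), ∃ y, adj x y ∧
      (gameStep adj f)^[m] g y ≤ (⨅ y : {y // adj x y}, (gameStep adj f)^[m] g y) + η := by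
    intro m x
    have : Nonempty {y // adj x y} := ⟨⟨x, hadj x⟩⟩
    obtain ⟨y, hy⟩ := exists_lt_of_ciInf_lt
      (lt_add_of_pos_right (⨅ y : {y // adj x y}, (gameStep adj f)^[m] g y) hη)
    exact ⟨y, y.2, hy.le⟩
  choose mv hmv hval using key
  refine ⟨⟨fun h x => mv (n - h.length - 1) x, fun h x => hmv _ x⟩, fun S m => ?_⟩
  induction m with
  | zero => intro h x _; simp [expectedPayoff]
  | succ m ih =>
    intro h x hm
    have hb := exists_abs_gameStep_iterate_le hadj hf hg m
    have h1 := ih ((x, false) :: h) (mv (n - h.length - 1) x) (by simp; omega)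
    have h2 := ih ((x, true) :: h) (S.move h x) (by simp; omega)
    have h3 := hval m x
    have h4 := le_iSup_adj hb (S.adj_move h x)
    have h5 : n - h.length - 1 = m := by omega
    rw [Function.iterate_succ_apply', gameStep, midrange, expectedPayoff]
    simp only [h5] at h1 ⊢
    push_cast
    linarith

/-- The value of the game is computed by dynamic programming. -/
theorem gameValue_eq_iterate (hadj : ∀ x, adj x x) {f g : V → ℝ} {F G : ℝ}
    (hf : ∀ x, |f x| ≤ F) (hg : ∀ x, |g x| ≤ G) (n : ℕ) (x : V) :
    gameValue adj f g n x = (gameStep adj f)^[n] g x := by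
  have hne : Nonempty (Strategy adj) := ⟨⟨fun _ x => x, fun _ x => hadj x⟩⟩
  have hb := fun S T => expectedPayoff_le (adj := adj) hf hg S T n [] x
  have hbelow : ∀ S : Strategy adj, BddBelow (range fun T => expectedPayoff f g S T n [] x) :=
    fun S => bddBelow_range_of_abs_le (hb S)
  have habove : BddAbove (range fun S : Strategy adj =>
      ⨅ T : Strategy adj, expectedPayoff f g S T n [] x) := by
    refine ⟨n * F + G, ?_⟩
    rintro _ ⟨S, rfl⟩
    exact (ciInf_le (hbelow S) hne.some).trans (abs_le.1 (hb S hne.some)).2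
  -- Suprema need not be attained, so the strategies lose η per step; the horizon is fixed, hence
  -- the total loss n η is arbitrarily small.
  have hsmall : ∀ {a b : ℝ}, (∀ η > 0, a ≤ b + n * η) → a ≤ b := by
    intro a b h
    refine le_of_forall_pos_le_add fun δ hδ => (h (δ / (n + 1)) (by positivity)).trans ?_
    have : (n : ℝ) * (δ / (n + 1)) ≤ δ := by
      rw [← mul_div_assoc, div_le_iff₀ (by positivity)]
      nlinarith
    linarith
  refine le_antisymm (hsmall fun η hη => ?_) (hsmall fun η hη => ?_)
  · obtain ⟨T, hT⟩ := exists_strategy_le hadj hf hg hη n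
    exact ciSup_le fun S => (ciInf_le (hbelow S) T).trans (hT S n [] x (by simp))
  · obtain ⟨S, hS⟩ := exists_strategy_ge hadj hf hg hη n
    have h1 : (gameStep adj f)^[n] g x - n * η ≤
        ⨅ T : Strategy adj, expectedPayoff f g S T n [] x :=
      le_ciInf fun T => hS T n [] x (by simp)
    have h2 := le_ciSup habove S
    unfold gameValue
    linarith

/-- The operator is monotone and commutes with constants, so it is nonexpansive. The shift b allows
functions to be compared modulo constants, where only their oscillation matters. -/
lemma abs_iterate_sub_le (hadj : ∀ x, adj x x) {f g g' : V → ℝ} {F G G' b c : ℝ}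
    (hf : ∀ x, |f x| ≤ F) (hg : ∀ x, |g x| ≤ G) (hg' : ∀ x, |g' x| ≤ G')
    (h : ∀ x, |g x - g' x - b| ≤ c) (n : ℕ) (x : V) :
    |(gameStep adj f)^[n] g x - (gameStep adj f)^[n] g' x - b| ≤ c := by
  induction n generalizing x with
  | zero => simpa using h x
  | succ n ih =>
    have h1 := exists_abs_gameStep_iterate_le hadj hf hg n
    have h2 := exists_abs_gameStep_iterate_le hadj hf hg' n
    have h3 := midrange_le_add hadj h1 h2 (x := x) (c := b + c)
      fun y _ => by linarith [(abs_le.1 (ih y)).2]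
    have h4 := midrange_le_add hadj h2 h1 (x := x) (c := c - b)
      fun y _ => by linarith [(abs_le.1 (ih y)).1]
    rw [Function.iterate_succ_apply', Function.iterate_succ_apply', gameStep, gameStep, abs_le]
    constructor <;> linarith

/-! ### Slopes of almost harmonic functions -/

/-- `k` bounds the graph distance of `x` and `y`, expressed by its consequence for functions whose
increments along edges are bounded. -/
def StepBound (adj : V → V → Prop) (x y : V) (k : ℝ) : Prop :=
  ∀ (u : V → ℝ) (S : ℝ), (∀ a b, adj a b → |u a - u b| ≤ S) → |u x - u y| ≤ k * S

/-- Follow the steepest ascent from an edge where the increment is nearly maximal. -/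
lemma exists_ascent (hadj : ∀ x, adj x x) (hsymm : ∀ x y, adj x y → adj y x) {u : V → ℝ}
    {B H S η : ℝ} (hu : ∀ x, |u x| ≤ B) (hH : ∀ x, |u x - midrange adj u x| ≤ H) (hη : 0 < η)
    {a₀ b₀ : V} (hab : adj a₀ b₀) (hS : S ≤ u b₀ - u a₀) (n : ℕ) :
    ∃ a b, adj a b ∧ S - n * (2 * H + η) ≤ u b - u a ∧
      (n + 1) * (S - n * (2 * H + η)) ≤ u b - u a₀ := by
  have hH0 : 0 ≤ H := (abs_nonneg _).trans (hH a₀)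
  induction n with
  | zero => exact ⟨a₀, b₀, hab, by simpa using hS, by simpa using hS⟩
  | succ n ih =>
    obtain ⟨a, b, h1, h2, h3⟩ := ih
    have : Nonempty {y // adj b y} := ⟨⟨b, hadj b⟩⟩
    obtain ⟨⟨c, hc⟩, hc'⟩ := exists_lt_of_lt_ciSup
      (sub_lt_self (⨆ y : {y // adj b y}, u y) hη)
    -- The previous vertex `a` is a neighbour of `b`, so the infimum at `b` is at most `u a`. As `u
    -- b` exceeds the midrange by at most H, the supremum lies above `u b` by at least the last
    -- increment minus 2H.
    have h4 := iInf_adj_le hu (hsymm _ _ h1)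
    have h5 := (abs_le.1 (hH b)).2
    unfold midrange at h5
    have h6 : S - (n + 1) * (2 * H + η) ≤ u c - u b := by
      simp only at hc'
      linarith
    refine ⟨b, c, hc, by push_cast; exact h6, ?_⟩
    push_cast
    have : 0 ≤ (n + 1) * (2 * H + η) := by positivity
    nlinarith

/-- If `u` is almost a fixed point of the averaging operator on a graph of diameter at most `k`,
then its increments along edges are bounded. -/
theorem abs_sub_le_of_abs_sub_midrange_le (hadj : ∀ x, adj x x)
    (hsymm : ∀ x y, adj x y → adj y x) {u : V → ℝ} {B H k : ℝ} (hu : ∀ x, |u x| ≤ B)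
    (hH : ∀ x, |u x - midrange adj u x| ≤ H) (hk : 1 ≤ k) (hstep : ∀ x y, StepBound adj x y k)
    {a b : V} (hab : adj a b) : |u a - u b| ≤ 24 * k * H := by
  have hH0 : 0 ≤ H := (abs_nonneg _).trans (hH a)
  have hbdd : BddAbove (range fun p : {p : V × V // adj p.1 p.2} => u p.1.2 - u p.1.1) := by
    refine ⟨2 * B, ?_⟩
    rintro _ ⟨p, rfl⟩
    linarith [(abs_le.1 (hu p.1.2)).2, (abs_le.1 (hu p.1.1)).1]
  set S := ⨆ p : {p : V × V // adj p.1 p.2}, (u p.1.2 - u p.1.1) with hSdef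
  have hle : ∀ x y, adj x y → u y - u x ≤ S := fun x y h =>
    le_ciSup hbdd (⟨(x, y), h⟩ : {p : V × V // adj p.1 p.2})
  have hne : Nonempty {p : V × V // adj p.1 p.2} := ⟨⟨(a, b), hab⟩⟩
  have habs : ∀ x y, adj x y → |u x - u y| ≤ S := fun x y h =>
    abs_le.2 ⟨by linarith [hle x y h], hle y x (hsymm _ _ h)⟩
  have hS0 : 0 ≤ S := (abs_nonneg _).trans (habs a b hab)
  refine (habs a b hab).trans ?_
  -- With n ≥ 2k the climb of n + 1 edges gives (n + 1 - k) S ≤ 2 n (n + 1) H, where n + 1 - k ≥ k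
  -- and n (n + 1) ≤ 12 k²; this is the source of the constant 24.
  set n := ⌈2 * k⌉₊
  have hn1 : 2 * k ≤ n := Nat.le_ceil _
  have hn2 : (n : ℝ) < 2 * k + 1 := Nat.ceil_lt_add_one (by linarith)
  have key : ∀ η > 0, (n + 1) * (S - n * (2 * H)) ≤ k * S + (n + 1) ^ 2 * η := by
    intro η hη
    obtain ⟨⟨⟨a₀, b₀⟩, hab₀⟩, hS⟩ := exists_lt_of_lt_ciSup (sub_lt_self S hη)
    obtain ⟨a', b', -, -, h⟩ := exists_ascent hadj hsymm hu hH hη hab₀ hS.le n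
    have h' := (abs_le.1 (hstep b' a₀ u S habs)).2
    simp only at h
    nlinarith
  have h1 : (n + 1) * (S - n * (2 * H)) ≤ k * S := by
    refine le_of_forall_pos_le_add fun δ hδ => ?_
    have := key (δ / (n + 1) ^ 2) (by positivity)
    rwa [mul_div_cancel₀ _ (by positivity)] at this
  have h2 : (n : ℝ) * (n + 1) ≤ 12 * k * k := by nlinarith
  have h3 : k * S ≤ k * (24 * k * H) := by nlinarith [mul_le_mul_of_nonneg_right h2 hH0]
  exact le_of_mul_le_mul_left h3 (by linarith)

/-! ### Existence of the long term advantage -/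

/-- The discounted game has an approximate solution. -/
lemma exists_discounted (hadj : ∀ x, adj x x) {f : V → ℝ} {F : ℝ} (hf : ∀ x, |f x| ≤ F)
    (hF : 0 ≤ F) {l δ : ℝ} (hl : 0 < l) (hl1 : l < 1) (hδ : 0 < δ) :
    ∃ u : V → ℝ, (∀ x, |u x| ≤ F / l) ∧
      ∀ x, |f x + (1 - l) * midrange adj u x - u x| ≤ δ := by
  -- `T` contracts by the factor 1 - l and preserves the bound F / l, so a sufficiently late iterate
  -- of 0 is almost fixed.
  let T : (V → ℝ) → V → ℝ := fun u x => f x + (1 - l) * midrange adj u x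
  have hl0 : 0 ≤ 1 - l := by linarith
  have hb : ∀ n x, |T^[n] (fun _ => 0) x| ≤ F / l := by
    intro n
    induction n with
    | zero => intro x; simpa using div_nonneg hF hl.le
    | succ n ih =>
      intro x
      rw [Function.iterate_succ_apply']
      refine (abs_add_le _ _).trans ?_
      rw [abs_mul, abs_of_nonneg hl0]
      have h1 := mul_le_mul_of_nonneg_left (abs_midrange_le hadj ih x) hl0
      have h2 : F + (1 - l) * (F / l) = F / l := by field_simp; ring
      linarith [hf x]
  have hd : ∀ n x, |T (T^[n] (fun _ => 0)) x - T^[n] (fun _ => 0) x| ≤ (1 - l) ^ n * F := by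
    intro n
    induction n with
    | zero => intro x; simpa [T, midrange_const hadj] using hf x
    | succ n ih =>
      intro x
      rw [Function.iterate_succ_apply']
      have hb' : ∀ x, |T (T^[n] fun _ => 0) x| ≤ F / l := fun x => by
        simpa only [Function.iterate_succ_apply'] using hb (n + 1) x
      have h1 := abs_midrange_sub_le hadj hb' (hb n) (x := x) fun y _ => ih y
      have h2 : T (T (T^[n] fun _ => 0)) x - T (T^[n] fun _ => 0) x = (1 - l) *
          (midrange adj (T (T^[n] fun _ => 0)) x - midrange adj (T^[n] fun _ => 0) x) := by
        simp only [T]; ring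
      rw [h2, abs_mul, abs_of_nonneg hl0, pow_succ', mul_assoc]
      gcongr
  have hlim : Tendsto (fun n => (1 - l) ^ n * F) atTop (𝓝 0) := by
    simpa using (tendsto_pow_atTop_nhds_zero_of_lt_one hl0 (by linarith)).mul_const F
  obtain ⟨n, hn⟩ := (hlim.eventually (gt_mem_nhds hδ)).exists
  exact ⟨T^[n] (fun _ => 0), hb n, fun x => (hd n x).trans hn.le⟩

/-- Approximate eigenfunctions of the dynamic programming operator, with bounds on increments that
do not depend on the quality of the approximation. -/
lemma exists_approx_eigenfunction [Nonempty V] (hadj : ∀ x, adj x x)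
    (hsymm : ∀ x y, adj x y → adj y x) {k : ℝ} (hk : 1 ≤ k) (hstep : ∀ x y, StepBound adj x y k)
    {f : V → ℝ} {F : ℝ} (hf : ∀ x, |f x| ≤ F) {τ : ℝ} (hτ : 0 < τ) :
    ∃ (u : V → ℝ) (B a : ℝ), (∀ x, |u x| ≤ B) ∧ (∀ x, |gameStep adj f u x - u x - a| ≤ τ) ∧
      ∀ x y, adj x y → |u x - u y| ≤ 24 * k * (2 * F + 1) := by
  obtain ⟨o⟩ := ‹Nonempty V›
  have hF : 0 ≤ F := (abs_nonneg _).trans (hf o)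
  set K := k * (24 * k * (2 * F + 1)) with hK
  have hK0 : 0 ≤ K := by positivity
  -- K bounds the oscillation of the discounted solution for every discount, so replacing l ·
  -- midrange u by the constant l · u(o) costs at most l K ≤ τ/2.
  set l := min (1 / 2) (τ / (2 * (K + 1)))
  have hl : 0 < l := by positivity
  have hl1 : l < 1 := (min_le_left _ _).trans_lt (by norm_num)
  have hlK : l * K ≤ τ / 2 := by
    have h1 : l ≤ τ / (2 * (K + 1)) := min_le_right _ _
    rw [le_div_iff₀ (by positivity)] at h1
    nlinarith
  have hδ : 0 < min 1 (τ / 2) := by positivity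
  obtain ⟨u, hu, hT⟩ := exists_discounted hadj hf hF hl hl1 hδ
  have hT1 := fun x => abs_le.1 ((hT x).trans (min_le_left _ _))
  have hT2 := fun x => abs_le.1 ((hT x).trans (min_le_right _ _))
  -- The bound |u| ≤ F / l blows up as l → 0, but the discount term stays below F. Hence u is within
  -- 2F + 1 of its midrange, whatever l is.
  have hlm : ∀ x, |l * midrange adj u x| ≤ F := fun x => by
    rw [abs_mul, abs_of_pos hl, mul_comm, ← le_div_iff₀ hl]
    exact abs_midrange_le hadj hu x
  have hslope : ∀ x y, adj x y → |u x - u y| ≤ 24 * k * (2 * F + 1) := fun x y hxy =>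
    abs_sub_le_of_abs_sub_midrange_le hadj hsymm hu (fun z => abs_le.2 ⟨by
      linarith [(abs_le.1 (hlm z)).2, (abs_le.1 (hf z)).1, (hT1 z).2], by
      linarith [(abs_le.1 (hlm z)).1, (abs_le.1 (hf z)).2, (hT1 z).1]⟩) hk hstep hxy
  refine ⟨u, F / l, l * u o, hu, fun x => ?_, hslope⟩
  have hm := abs_le.1 (abs_midrange_sub_const_le hadj hu (x := x) (b := u o) (c := K)
    fun y _ => hstep y o u _ hslope)
  have h3 := mul_le_mul_of_nonneg_left hm.1 hl.le
  have h4 := mul_le_mul_of_nonneg_left hm.2 hl.le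
  unfold gameStep
  rw [abs_le]
  constructor <;> nlinarith [(hT2 x).1, (hT2 x).2]

/-- If one step is a shift by a up to τ, nonexpansiveness preserves this error at each later step,
so the errors add up to n τ. -/
lemma abs_iterate_sub_mul_le (hadj : ∀ x, adj x x) {f u : V → ℝ} {F B a τ : ℝ}
    (hf : ∀ x, |f x| ≤ F) (hu : ∀ x, |u x| ≤ B) (h : ∀ x, |gameStep adj f u x - u x - a| ≤ τ)
    (n : ℕ) (x : V) : |(gameStep adj f)^[n] u x - u x - n * a| ≤ n * τ := by
  induction n generalizing x with
  | zero => simp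
  | succ n ih =>
    have h1 : ∀ x, |gameStep adj f u x| ≤ F + B := fun x =>
      (abs_add_le _ _).trans (add_le_add (hf x) (abs_midrange_le hadj hu x))
    have h2 := abs_le.1 (abs_iterate_sub_le hadj hf h1 hu h n x)
    have h3 := abs_le.1 (ih x)
    rw [Function.iterate_succ_apply]
    push_cast
    rw [abs_le]
    constructor <;> linarith

lemma le_of_forall_nat_mul_le {a b C : ℝ} (h : ∀ n : ℕ, n * a ≤ n * b + C) : a ≤ b := by
  by_contra! hab
  obtain ⟨n, hn⟩ := exists_nat_gt (C / (a - b))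
  rw [div_lt_iff₀ (by linarith)] at hn
  linarith [h n]

/-- On a connected graph of finite diameter, the long term advantage exists. -/
theorem exists_isLongTermAdvantage [Nonempty V] (hadj : ∀ x, adj x x)
    (hsymm : ∀ x y, adj x y → adj y x) {k : ℝ} (hk : 1 ≤ k) (hstep : ∀ x y, StepBound adj x y k)
    {f : V → ℝ} {F : ℝ} (hf : ∀ x, |f x| ≤ F) : ∃ c, IsLongTermAdvantage adj f c := by
  choose! u B a hu ha hslope using
    fun (τ : ℝ) (hτ : 0 < τ) => exists_approx_eigenfunction hadj hsymm hk hstep hf hτ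
  obtain ⟨o⟩ := ‹Nonempty V›
  set K := k * (24 * k * (2 * F + 1))
  have hosc : ∀ τ > 0, ∀ x, |0 - u τ x - (-u τ o)| ≤ K := fun τ hτ x => by
    have := hstep o x (u τ) _ (hslope τ hτ)
    rwa [show 0 - u τ x - (-u τ o) = u τ o - u τ x by ring]
  have h0 : ∀ x : V, |(fun _ => 0 : V → ℝ) x| ≤ 0 := by simp
  have key : ∀ τ > 0, ∀ (n : ℕ) x,
      |(gameStep adj f)^[n] (fun _ => 0) x - n * a τ| ≤ 2 * K + n * τ := by
    intro τ hτ n x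
    have h1 := abs_le.1 (abs_iterate_sub_le hadj hf h0 (hu τ hτ) (hosc τ hτ) n x)
    have h2 := abs_le.1 (abs_iterate_sub_mul_le hadj hf (hu τ hτ) (ha τ hτ) n x)
    have h3 := abs_le.1 (hosc τ hτ x)
    rw [abs_le]
    constructor <;> linarith
  -- Comparing the growth of the same iterates shows that the intervals [a τ - τ, a τ + τ] meet
  -- pairwise; hence they have a common point, which is the advantage.
  have hcross : ∀ τ > 0, ∀ σ > 0, a τ - τ ≤ a σ + σ := by
    intro τ hτ σ hσ
    refine le_of_forall_nat_mul_le (C := 4 * K) fun n => ?_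
    linarith [(abs_le.1 (key τ hτ n o)).1, (abs_le.1 (key τ hτ n o)).2,
      (abs_le.1 (key σ hσ n o)).1, (abs_le.1 (key σ hσ n o)).2]
  obtain ⟨c, hc1, hc2⟩ : ∃ c, (∀ τ > 0, a τ - τ ≤ c) ∧ ∀ τ > 0, c ≤ a τ + τ := by
    refine ⟨⨆ τ : Ioi (0 : ℝ), (a τ - τ), fun τ hτ => ?_, fun σ hσ => ?_⟩
    · refine le_ciSup (f := fun τ : Ioi (0 : ℝ) => a τ - τ) ⟨a 1 + 1, ?_⟩ ⟨τ, hτ⟩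
      rintro _ ⟨τ, rfl⟩
      exact hcross τ τ.2 1 one_pos
    · have : Nonempty (Ioi (0 : ℝ)) := ⟨⟨1, mem_Ioi.2 one_pos⟩⟩
      exact ciSup_le fun τ => hcross τ τ.2 σ hσ
  have hbound : ∀ (n : ℕ) x, |(gameStep adj f)^[n] (fun _ => 0) x - n * c| ≤ 2 * K := by
    intro n x
    refine le_of_forall_pos_le_add fun δ hδ => ?_
    -- The accuracy may depend on n since K does not depend on τ; this is what makes the final bound
    -- uniform in n.
    have hτ : 0 < δ / (2 * n + 1) := by positivity
    have h1 := abs_le.1 (key _ hτ n x)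
    have h2 : 2 * (n * (δ / (2 * n + 1))) ≤ δ := by
      rw [← mul_div_assoc, ← mul_div_assoc, div_le_iff₀ (by positivity)]
      nlinarith
    have hn : (0 : ℝ) ≤ n := n.cast_nonneg
    have h3 := mul_le_mul_of_nonneg_left (hc1 _ hτ) hn
    have h4 := mul_le_mul_of_nonneg_left (hc2 _ hτ) hn
    rw [abs_le]
    constructor <;> linarith
  refine ⟨c, fun g ⟨G, hg⟩ => ⟨G + 2 * K, fun n x => ?_⟩⟩
  rw [gameValue_eq_iterate hadj hf hg]
  have h1 := abs_le.1 (abs_iterate_sub_le hadj hf hg h0 (b := 0) (c := G) (by simpa using hg) n x)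
  have h2 := abs_le.1 (hbound n x)
  rw [abs_le]
  constructor <;> linarith

/-- Approximate solutions of the stationary equation for the long term advantage. -/
theorem exists_approx_solution [Nonempty V] (hadj : ∀ x, adj x x)
    (hsymm : ∀ x y, adj x y → adj y x) {k : ℝ} (hk : 1 ≤ k) (hstep : ∀ x y, StepBound adj x y k)
    {f : V → ℝ} {F : ℝ} (hf : ∀ x, |f x| ≤ F) {τ : ℝ} (hτ : 0 < τ) :
    ∃ (u : V → ℝ) (B : ℝ), (∀ x, |u x| ≤ B) ∧
      (∀ x, |f x + midrange adj u x - u x - longTermAdvantage adj f| ≤ τ) ∧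
      ∀ x y, adj x y → |u x - u y| ≤ 24 * k * (2 * F + 1) := by
  obtain ⟨u, B, a, hu, ha, hslope⟩ :=
    exists_approx_eigenfunction hadj hsymm hk hstep hf (half_pos hτ)
  refine ⟨u, B, hu, fun x => ?_, hslope⟩
  -- The defining property is applied with the approximate eigenfunction itself as terminal payoff:
  -- its iterates grow at rate a up to τ/2, hence a is within τ/2 of the advantage.
  obtain ⟨C, hC⟩ := Classical.epsilon_spec (exists_isLongTermAdvantage hadj hsymm hk hstep hf)
    u ⟨B, hu⟩
  change ∀ (n : ℕ) x, |_ - n * longTermAdvantage adj f| ≤ C at hC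
  have key : ∀ n : ℕ, |n * a - n * longTermAdvantage adj f| ≤ n * (τ / 2) + (B + C) := by
    intro n
    have h1 := abs_le.1 (hC n x)
    rw [gameValue_eq_iterate hadj hf hu] at h1
    have h2 := abs_le.1 (abs_iterate_sub_mul_le hadj hf hu ha n x)
    have h3 := abs_le.1 (hu x)
    rw [abs_le]
    constructor <;> linarith
  have h1 : a ≤ longTermAdvantage adj f + τ / 2 :=
    le_of_forall_nat_mul_le (C := B + C) fun n => by linarith [(abs_le.1 (key n)).2]
  have h2 : longTermAdvantage adj f ≤ a + τ / 2 :=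
    le_of_forall_nat_mul_le (C := B + C) fun n => by linarith [(abs_le.1 (key n)).1]
  have h3 := abs_le.1 (ha x)
  unfold gameStep at h3
  rw [abs_le]
  constructor <;> linarith

end Graph

/-! ### Step bounds -/

section StepBound

variable {V : Type*} {adj : V → V → Prop}

lemma StepBound.mono (hadj : ∀ x, adj x x) {x y : V} {k l : ℝ} (h : StepBound adj x y k)
    (hkl : k ≤ l) : StepBound adj x y l := fun u S hS =>
  (h u S hS).trans (mul_le_mul_of_nonneg_right hkl ((abs_nonneg _).trans (hS x x (hadj x))))

lemma StepBound.symm {x y : V} {k : ℝ} (h : StepBound adj x y k) : StepBound adj y x k :=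
  fun u S hS => by rw [abs_sub_comm]; exact h u S hS

lemma StepBound.trans {x y z : V} {k l : ℝ} (h : StepBound adj x y k)
    (h' : StepBound adj y z l) : StepBound adj x z (k + l) := fun u S hS => by
  rw [add_mul]
  exact (abs_sub_le _ (u y) _).trans (add_le_add (h u S hS) (h' u S hS))

/-- On a compact connected space, local bounds on the number of steps give global bounds. -/
theorem exists_stepBound_of_local {X : Type*} [MetricSpace X] [CompactSpace X]
    [PreconnectedSpace X] [Nonempty X] {A : ℝ → X → X → Prop} (hA : ∀ ε x, A ε x x)
    (hloc : ∀ x₀ : X, ∃ r > 0, ∃ C, 0 ≤ C ∧ ∀ x ∈ Metric.ball x₀ r, ∀ y ∈ Metric.ball x₀ r,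
      ∀ ε > 0, StepBound (A ε) x y (C * dist x y / ε + 1)) :
    ∃ C, 0 ≤ C ∧ ∀ x y, ∀ ε > 0, ε ≤ 1 → StepBound (A ε) x y (C * dist x y / ε + 1) := by
  have hloc' : ∀ x₀ : X, ∃ r > 0, ∃ C, ∀ x ∈ Metric.ball x₀ r, ∀ ε > 0, ε ≤ 1 →
      StepBound (A ε) x₀ x (C / ε) := by
    intro x₀
    obtain ⟨r, hr, C, hC, h⟩ := hloc x₀
    refine ⟨r, hr, C * r + 1, fun x hx ε hε hε1 => ?_⟩
    refine (h x₀ (Metric.mem_ball_self hr) x hx ε hε).mono (hA ε) ?_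
    -- Since ε ≤ 1, the additive 1 can be absorbed into a multiple of 1/ε.
    rw [div_add_one hε.ne']
    have : C * dist x₀ x ≤ C * r := by
      gcongr
      exact (Metric.mem_ball'.1 hx).le
    gcongr
  have hrel : ∀ x y : X, ∃ C, ∀ ε > 0, ε ≤ 1 → StepBound (A ε) x y (C / ε) := by
    intro x y
    refine isPreconnected_univ.induction₂
      (fun x y => ∃ C, ∀ ε > 0, ε ≤ 1 → StepBound (A ε) x y (C / ε)) ?_ ?_ ?_
      (mem_univ x) (mem_univ y)
    · intro x _
      obtain ⟨r, hr, C, h⟩ := hloc' x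
      rw [nhdsWithin_univ]
      exact mem_of_superset (Metric.ball_mem_nhds x hr) fun y hy => ⟨C, h y hy⟩
    · rintro x y z _ _ _ ⟨C, h⟩ ⟨C', h'⟩
      exact ⟨C + C', fun ε hε hε1 => by
        rw [add_div]; exact (h ε hε hε1).trans (h' ε hε hε1)⟩
    · rintro x y _ _ ⟨C, h⟩
      exact ⟨C, fun ε hε hε1 => (h ε hε hε1).symm⟩
  obtain ⟨o⟩ := ‹Nonempty X›
  obtain ⟨D, hD⟩ : ∃ C, ∀ x ∈ (univ : Set X), ∀ ε > 0, ε ≤ 1 → StepBound (A ε) o x (C / ε) := by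
    refine isCompact_univ.induction_on
      (p := fun s => ∃ C, ∀ x ∈ s, ∀ ε > 0, ε ≤ 1 → StepBound (A ε) o x (C / ε)) ?_ ?_ ?_ ?_
    · exact ⟨0, by simp⟩
    · rintro s t hst ⟨C, h⟩
      exact ⟨C, fun x hx => h x (hst hx)⟩
    · rintro s t ⟨C, h⟩ ⟨C', h'⟩
      refine ⟨max C C', ?_⟩
      rintro x (hx | hx) ε hε hε1
      · exact (h x hx ε hε hε1).mono (hA ε) (by gcongr; exact le_max_left _ _)
      · exact (h' x hx ε hε hε1).mono (hA ε) (by gcongr; exact le_max_right _ _)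
    · intro x _
      obtain ⟨r, hr, C, h⟩ := hloc' x
      obtain ⟨C', h'⟩ := hrel o x
      refine ⟨Metric.ball x r, ?_, C' + C, fun y hy ε hε hε1 => ?_⟩
      · rw [nhdsWithin_univ]; exact Metric.ball_mem_nhds x hr
      · rw [add_div]; exact (h' ε hε hε1).trans (h y hy ε hε hε1)
  have hD0 : ∀ x y, ∀ ε > 0, ε ≤ 1 → StepBound (A ε) x y (2 * |D| / ε) := fun x y ε hε hε1 =>
    ((hD x trivial ε hε hε1).symm.trans (hD y trivial ε hε hε1)).mono (hA ε) (by
      rw [← add_div, ← two_mul]; gcongr; exact le_abs_self D)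
  suffices h : ∃ C, 0 ≤ C ∧ ∀ p ∈ (univ : Set (X × X)), ∀ ε > 0, ε ≤ 1 →
      StepBound (A ε) p.1 p.2 (C * dist p.1 p.2 / ε + 1) by
    obtain ⟨C, hC, h⟩ := h
    exact ⟨C, hC, fun x y => h (x, y) trivial⟩
  refine isCompact_univ.induction_on
    (p := fun s => ∃ C, 0 ≤ C ∧ ∀ p : X × X, p ∈ s → ∀ ε > 0, ε ≤ 1 →
      StepBound (A ε) p.1 p.2 (C * dist p.1 p.2 / ε + 1)) ?_ ?_ ?_ ?_
  · exact ⟨0, le_rfl, by simp⟩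
  · rintro s t hst ⟨C, hC, h⟩
    exact ⟨C, hC, fun p hp => h p (hst hp)⟩
  · rintro s t ⟨C, hC, h⟩ ⟨C', hC', h'⟩
    refine ⟨max C C', hC.trans (le_max_left _ _), ?_⟩
    rintro p (hp | hp) ε hε hε1
    · exact (h p hp ε hε hε1).mono (hA ε) (by gcongr; exact le_max_left _ _)
    · exact (h' p hp ε hε hε1).mono (hA ε) (by gcongr; exact le_max_right _ _)
  -- Near the diagonal of the product the local hypothesis applies. Away from it the distance is
  -- bounded below, so the crude global bound 2|D|/ε is already proportional to the distance.
  · rintro ⟨x, y⟩ _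
    rw [nhdsWithin_univ]
    rcases eq_or_ne x y with rfl | hxy
    · obtain ⟨r, hr, C, hC, h⟩ := hloc x
      exact ⟨Metric.ball x r ×ˢ Metric.ball x r,
        prod_mem_nhds (Metric.ball_mem_nhds x hr) (Metric.ball_mem_nhds x hr), C, hC,
        fun p hp ε hε _ => h _ hp.1 _ hp.2 ε hε⟩
    · have hd : 0 < dist x y := dist_pos.2 hxy
      refine ⟨{p | dist x y / 2 < dist p.1 p.2},
        (isOpen_lt continuous_const continuous_dist).mem_nhds (half_lt_self hd),
        2 * |D| / (dist x y / 2), by positivity, fun p hp ε hε hε1 => ?_⟩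
      refine (hD0 p.1 p.2 ε hε hε1).mono (hA ε) ?_
      have h1 : 2 * |D| ≤ 2 * |D| / (dist x y / 2) * dist p.1 p.2 := by
        rw [div_mul_eq_mul_div, le_div_iff₀ (by positivity)]
        exact mul_le_mul_of_nonneg_left (le_of_lt hp) (by positivity)
      have h2 : 2 * |D| / ε ≤ 2 * |D| / (dist x y / 2) * dist p.1 p.2 / ε := by gcongr
      linarith

end StepBound

/-! ### The adjacency graph of a space with its intrinsic distance -/

lemma epsAdj_refl (X : Type*) [MetricSpace X] (ε : ℝ) (x : X) : epsAdj X ε x x := by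
  refine (iInf_le _ (Path.refl x)).trans ?_
  rw [eVariationOn.constant_on]
  · exact zero_le
  · rintro _ ⟨a, -, rfl⟩ _ ⟨b, -, rfl⟩
    simp

lemma intrinsicEDist_le_swap {X : Type*} [MetricSpace X] (x y : X) :
    intrinsicEDist y x ≤ intrinsicEDist x y := by
  refine le_iInf fun p => (iInf_le _ p.symm).trans ?_
  exact eVariationOn.comp_le_of_antitoneOn p (t := univ) unitInterval.symm
    (fun a _ b _ h => unitInterval.symm_le_symm.2 h) (mapsTo_univ _ _)

lemma epsAdj_symm (X : Type*) [MetricSpace X] (ε : ℝ) (x y : X) (h : epsAdj X ε x y) :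
    epsAdj X ε y x :=
  (intrinsicEDist_le_swap x y).trans h

lemma edist_le_intrinsicEDist {X : Type*} [MetricSpace X] (x y : X) :
    edist x y ≤ intrinsicEDist x y := by
  refine le_iInf fun p => ?_
  simpa using eVariationOn.edist_le p (mem_univ (0 : unitInterval)) (mem_univ (1 : unitInterval))

lemma dist_le_of_epsAdj {X : Type*} [MetricSpace X] {ε : ℝ} (hε : 0 ≤ ε) {x y : X}
    (h : epsAdj X ε x y) : dist x y ≤ ε := by
  have := (edist_le_intrinsicEDist x y).trans h
  rwa [edist_dist, ENNReal.ofReal_le_ofReal_iff hε] at this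

/-- A K-Lipschitz curve on the unit interval has length at most K. Exhibiting such curves is how
edges of the graph are produced. -/
lemma epsAdj_of_lipschitzOnWith {A : Set (E d)} {c : ℝ → E d} {K : ℝ≥0} {ε : ℝ}
    (hc : LipschitzOnWith K c (Icc 0 1)) (hA : ∀ t ∈ Icc (0 : ℝ) 1, c t ∈ A) (hK : K ≤ ε)
    {x y : A} (hx : c 0 = x) (hy : c 1 = y) : epsAdj A ε x y := by
  let p : Path x y :=
    { toFun := fun t => ⟨c t, hA t t.2⟩
      continuous_toFun := by
        refine Continuous.subtype_mk ?_ _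
        exact hc.continuousOn.comp_continuous continuous_subtype_val fun t => t.2
      source' := Subtype.ext (by simpa using hx)
      target' := Subtype.ext (by simpa using hy) }
  have hp : LipschitzWith K p := fun a b => hc a.2 b.2
  have h1 : eVariationOn p univ ≤ K * eVariationOn (id : unitInterval → unitInterval) univ :=
    (hp.lipschitzOnWith (s := univ)).comp_eVariationOn_le (mapsTo_univ _ _)
  have h2 : eVariationOn (id : unitInterval → unitInterval) univ ≤ 1 := by
    have hu : (univ : Set unitInterval) ∩ Icc 0 1 = univ := by
      ext t; simp [unitInterval.le_one']
    have : eVariationOn (fun t : unitInterval => (t : ℝ)) (univ ∩ Icc 0 1) =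
        ENNReal.ofReal (1 - 0) :=
      MonotoneOn.eVariationOn_eq (f := fun t : unitInterval => (t : ℝ))
        (fun a _ b _ h => h) (mem_univ 0) (mem_univ 1)
    rw [hu, sub_zero, ENNReal.ofReal_one] at this
    exact this.le
  refine (iInf_le _ p).trans (h1.trans ?_)
  calc (K : ℝ≥0∞) * eVariationOn (id : unitInterval → unitInterval) univ ≤ K * 1 := by gcongr
    _ = ENNReal.ofReal K := by simp
    _ ≤ ENNReal.ofReal ε := ENNReal.ofReal_le_ofReal hK

/-- Cut the curve into n = ⌊K/ε⌋ + 1 equal pieces: each is K/n-Lipschitz after reparametrization,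
and K/n ≤ ε, so consecutive endpoints are adjacent. -/
lemma stepBound_of_lipschitzOnWith {A : Set (E d)} {c : ℝ → E d} {K : ℝ≥0} {ε : ℝ} (hε : 0 < ε)
    (hc : LipschitzOnWith K c (Icc 0 1)) (hA : ∀ t ∈ Icc (0 : ℝ) 1, c t ∈ A)
    {x y : A} (hx : c 0 = x) (hy : c 1 = y) : StepBound (epsAdj A ε) x y (K / ε + 1) := by
  intro u S hS
  set n := ⌊K / ε⌋₊ + 1 with hn
  have hn0 : (0 : ℝ) < n := by positivity
  have hn1 : (K : ℝ) / ε ≤ n := by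
    rw [hn]; push_cast; exact (Nat.lt_floor_add_one _).le
  have hn2 : (n : ℝ) ≤ K / ε + 1 := by
    rw [hn]; push_cast; gcongr; exact Nat.floor_le (by positivity)
  have hmem : ∀ i : ℕ, i ≤ n → ∀ s ∈ Icc (0 : ℝ) 1, i + 1 ≤ n → (i + s) / n ∈ Icc (0 : ℝ) 1 := by
    intro i _ s hs hi
    have : (i : ℝ) + 1 ≤ n := by exact_mod_cast hi
    exact ⟨div_nonneg (add_nonneg i.cast_nonneg hs.1) hn0.le,
      (div_le_one hn0).2 (by linarith [hs.2])⟩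
  have hmem' : ∀ i : ℕ, i ≤ n → (i : ℝ) / n ∈ Icc (0 : ℝ) 1 := fun i hi =>
    ⟨by positivity, (div_le_one hn0).2 (by exact_mod_cast hi)⟩
  have hadj : ∀ (i : ℕ) (hi : i + 1 ≤ n),
      epsAdj A ε ⟨c (i / n), hA _ (hmem' i (by omega))⟩
        ⟨c ((i + 1 : ℕ) / n), hA _ (hmem' (i + 1) hi)⟩ := by
    intro i hi
    refine epsAdj_of_lipschitzOnWith (c := fun s => c ((i + s) / n)) (K := K / n) ?_
      (fun s hs => hA _ (hmem i (by omega) s hs hi)) ?_ (by simp) (by simp)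
    · refine LipschitzOnWith.of_dist_le_mul fun s hs t ht => ?_
      refine (hc.dist_le_mul _ (hmem i (by omega) s hs hi) _
        (hmem i (by omega) t ht hi)).trans (le_of_eq ?_)
      rw [Real.dist_eq, Real.dist_eq, ← sub_div, add_sub_add_left_eq_sub, abs_div,
        abs_of_pos hn0]
      push_cast
      ring
    · push_cast
      rw [div_le_iff₀ hn0, mul_comm]
      rwa [div_le_iff₀ hε] at hn1
  have hsum : ∀ (i : ℕ) (hi : i ≤ n), |u x - u ⟨c (i / n), hA _ (hmem' i hi)⟩| ≤ i * S := by
    intro i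
    induction i with
    | zero =>
      intro hi
      have : (⟨c ((0 : ℕ) / n), hA _ (hmem' 0 hi)⟩ : A) = x := Subtype.ext (by simpa using hx)
      rw [this]; simp
    | succ i ih =>
      intro hi
      refine (abs_sub_le _ (u ⟨c (i / n), hA _ (hmem' i (by omega))⟩) _).trans ?_
      have h1 := ih (by omega)
      have h2 := hS _ _ (hadj i hi)
      push_cast at h2 ⊢
      linarith
  have h1 := hsum n le_rfl
  have h2 : (⟨c ((n : ℕ) / n), hA _ (hmem' n le_rfl)⟩ : A) = y :=
    Subtype.ext (by simpa [div_self hn0.ne'] using hy)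
  rw [h2] at h1
  exact h1.trans (mul_le_mul_of_nonneg_right hn2
    ((abs_nonneg _).trans (hS x x (epsAdj_refl _ _ _))))

/-! ### Geometry of domains with `C^1` boundary -/

/-- Moving along `e` does not change the projection, so the defining function drops at exactly unit
rate. This is the means of pushing points below the graph. -/
lemma graphFun_sub_smul {e : E d} (he : ‖e‖ = 1) (γ : E d → ℝ) (y : E d) (t : ℝ) :
    graphFun e γ (y - t • e) = graphFun e γ y - t := by
  have h1 : ⟪e, y - t • e⟫ = ⟪e, y⟫ - t := by
    rw [inner_sub_right, inner_smul_right, real_inner_self_eq_norm_sq, he]; ring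
  have h2 : y - t • e - (⟪e, y⟫ - t) • e = y - ⟪e, y⟫ • e := by
    rw [sub_smul]; abel
  rw [graphFun, graphFun, h1, h2]
  ring

lemma contDiff_graphFun (e : E d) {γ : E d → ℝ} (hγ : ContDiff ℝ 1 γ) :
    ContDiff ℝ 1 (graphFun e γ) := by
  have h : ContDiff ℝ 1 fun y : E d => ⟪e, y⟫ := contDiff_const.inner ℝ contDiff_id
  exact h.sub (hγ.comp (contDiff_id.sub (h.smul contDiff_const)))

lemma IsGraphChart.mem_closure_iff {Ω : Set (E d)} {x e : E d} {r : ℝ} {γ : E d → ℝ}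
    (h : IsGraphChart Ω x e r γ) {y : E d} (hy : y ∈ Metric.ball x r) :
    y ∈ closure Ω ↔ graphFun e γ y ≤ 0 := by
  obtain ⟨he, hr, hγ, hΩ⟩ := h
  have hcont := (contDiff_graphFun e hγ).continuous
  constructor
  · intro hyc
    by_contra! hpos
    have hopen : IsOpen (Metric.ball x r ∩ graphFun e γ ⁻¹' Ioi 0) :=
      Metric.isOpen_ball.inter (isOpen_Ioi.preimage hcont)
    obtain ⟨z, ⟨hz1, hz2⟩, hz3⟩ := _root_.mem_closure_iff.1 hyc _ hopen ⟨hy, hpos⟩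
    exact absurd ((hΩ z hz1).1 hz3) (not_lt.2 (le_of_lt hz2))
  · intro hle
    have hlim : Tendsto (fun t : ℝ => y - t • e) (𝓝[>] 0) (𝓝 y) := by
      have : Continuous fun t : ℝ => y - t • e := by fun_prop
      simpa using (this.tendsto 0).mono_left nhdsWithin_le_nhds
    refine mem_closure_of_tendsto hlim ?_
    filter_upwards [hlim.eventually (Metric.isOpen_ball.mem_nhds hy), self_mem_nhdsWithin]
      with t ht ht0
    rw [hΩ _ ht, graphFun_sub_smul he]
    linarith [mem_Ioi.1 ht0]

/-- Near a boundary point, two points of the closure are joined by a short curve. -/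
lemma IsGraphChart.exists_curve {Ω : Set (E d)} {x₀ e : E d} {r : ℝ} {γ : E d → ℝ}
    (h : IsGraphChart Ω x₀ e r γ) : ∃ ρ > 0, ∃ C : ℝ≥0, ∀ x ∈ closure Ω ∩ Metric.ball x₀ ρ,
      ∀ y ∈ closure Ω ∩ Metric.ball x₀ ρ, ∃ c : ℝ → E d,
        LipschitzOnWith (C * nndist x y) c (Icc 0 1) ∧ (∀ t ∈ Icc (0 : ℝ) 1, c t ∈ closure Ω) ∧
        c 0 = x ∧ c 1 = y := by
  obtain ⟨he, hr, hγ, -⟩ := id h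
  obtain ⟨K, s, hs, hK⟩ :=
    ((contDiff_graphFun e hγ).contDiffAt (x := x₀)).exists_lipschitzOnWith
  obtain ⟨r₁, hr₁, hs⟩ := Metric.mem_nhds_iff.1 hs
  -- The curve below stays within 2Kρ of a segment in the ball of radius ρ, so it remains in the
  -- ball where the chart is valid.
  set ρ := min r₁ (r / (1 + 2 * K))
  have hρ : 0 < ρ := by positivity
  have hρ1 : ρ ≤ r₁ := min_le_left _ _
  have hρ2 : ρ + 2 * K * ρ ≤ r := by
    have : ρ ≤ r / (1 + 2 * K) := min_le_right _ _
    rw [le_div_iff₀ (by positivity)] at this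
    linarith
  refine ⟨ρ, hρ, 1 + K, fun x hx y hy => ?_⟩
  have hxy : dist x y ≤ 2 * ρ := by
    linarith [dist_triangle_right x y x₀, Metric.mem_ball.1 hx.2, Metric.mem_ball.1 hy.2]
  have hball : ∀ z ∈ Metric.ball x₀ ρ, z ∈ Metric.ball x₀ r := fun z hz =>
    Metric.ball_subset_ball (by nlinarith [K.2]) hz
  have hGx := (h.mem_closure_iff (hball x hx.2)).1 hx.1
  have hGy := (h.mem_closure_iff (hball y hy.2)).1 hy.1
  -- The segment may leave the domain, but along it the defining function is at most K |x - y|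
  -- min(t, 1 - t), by comparison with the nearer endpoint. Lowering it along `e` by this tent
  -- compensates exactly.
  refine ⟨fun t => x + t • (y - x) - (K * dist x y * min t (1 - t)) • e, ?_, ?_, by simp, by simp⟩
  · refine LipschitzOnWith.of_dist_le_mul fun a _ b _ => ?_
    have h1 : |min a (1 - a) - min b (1 - b)| ≤ |a - b| := by
      refine (abs_min_sub_min_le_max _ _ _ _).trans (max_le le_rfl (le_of_eq ?_))
      rw [← abs_neg]; congr 1; ring
    have h2 : x + a • (y - x) - (K * dist x y * min a (1 - a)) • e -
        (x + b • (y - x) - (K * dist x y * min b (1 - b)) • e) =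
        (a - b) • (y - x) - (K * dist x y * (min a (1 - a) - min b (1 - b))) • e := by
      module
    rw [dist_eq_norm, h2, Real.dist_eq]
    refine (norm_sub_le _ _).trans ?_
    rw [norm_smul, norm_smul, he, Real.norm_eq_abs, Real.norm_eq_abs, abs_mul, ← dist_eq_norm,
      dist_comm y x, abs_of_nonneg (by positivity : (0 : ℝ) ≤ K * dist x y)]
    have h3 := mul_le_mul_of_nonneg_left h1 (by positivity : (0 : ℝ) ≤ K * dist x y)
    push_cast
    nlinarith
  · intro t ht
    have hp : x + t • (y - x) ∈ Metric.ball x₀ ρ :=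
      (convex_ball x₀ ρ).add_smul_sub_mem hx.2 hy.2 ht
    have hm0 : 0 ≤ min t (1 - t) := le_min ht.1 (by linarith [ht.2])
    have hm1 : min t (1 - t) ≤ 1 := (min_le_left _ _).trans ht.2
    have hz : x + t • (y - x) - (K * dist x y * min t (1 - t)) • e ∈ Metric.ball x₀ r := by
      rw [Metric.mem_ball]
      have h1 : dist (x + t • (y - x) - (K * dist x y * min t (1 - t)) • e) (x + t • (y - x)) ≤
          2 * K * ρ := by
        rw [dist_eq_norm, sub_sub_cancel_left, norm_neg, norm_smul, he, mul_one,
          Real.norm_of_nonneg (by positivity)]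
        calc K * dist x y * min t (1 - t) ≤ K * (2 * ρ) * 1 := by gcongr
          _ = 2 * K * ρ := by ring
      linarith [dist_triangle (x + t • (y - x) - (K * dist x y * min t (1 - t)) • e)
        (x + t • (y - x)) x₀, Metric.mem_ball.1 hp]
    rw [h.mem_closure_iff hz, graphFun_sub_smul he]
    have hsub : ∀ z ∈ Metric.ball x₀ ρ, z ∈ s := fun z hz =>
      hs (Metric.ball_subset_ball hρ1 hz)
    have h1 := hK.dist_le_mul _ (hsub _ hp) _ (hsub _ hx.2)
    have h2 := hK.dist_le_mul _ (hsub _ hp) _ (hsub _ hy.2)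
    have h3 : dist (x + t • (y - x)) x = t * dist x y := by
      rw [dist_eq_norm, add_sub_cancel_left, norm_smul, Real.norm_of_nonneg ht.1, dist_comm,
        dist_eq_norm]
    have h4 : dist (x + t • (y - x)) y = (1 - t) * dist x y := by
      rw [dist_eq_norm, show x + t • (y - x) - y = (1 - t) • (x - y) by module, norm_smul,
        Real.norm_of_nonneg (by linarith [ht.2]), dist_eq_norm]
    rw [h3, Real.dist_eq] at h1
    rw [h4, Real.dist_eq] at h2
    rcases min_choice t (1 - t) with hm | hm <;> rw [hm]
    · nlinarith [(abs_le.1 h1).2]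
    · nlinarith [(abs_le.1 h2).2]

/-- The number of steps between two points of the closure is controlled by their distance. -/
theorem exists_stepBound {Ω : Set (E d)} (hopen : IsOpen Ω) (hconn : IsConnected Ω)
    (hbdd : Bornology.IsBounded Ω) (hC1 : HasC1Boundary Ω) :
    ∃ C, 0 ≤ C ∧ ∀ x y : closure Ω, ∀ ε > 0, ε ≤ 1 →
      StepBound (epsAdj (closure Ω) ε) x y (C * dist x y / ε + 1) := by
  have : CompactSpace (closure Ω) :=
    isCompact_iff_compactSpace.1 hbdd.isCompact_closure
  have : PreconnectedSpace (closure Ω) :=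
    isPreconnected_iff_preconnectedSpace.1 hconn.isPreconnected.closure
  have : Nonempty (closure Ω) := hconn.nonempty.closure.to_subtype
  refine exists_stepBound_of_local (fun ε x => epsAdj_refl _ ε x) fun x₀ => ?_
  have hcurve : ∃ ρ > 0, ∃ C : ℝ≥0, ∀ x ∈ closure Ω ∩ Metric.ball (x₀ : E d) ρ,
      ∀ y ∈ closure Ω ∩ Metric.ball (x₀ : E d) ρ, ∃ c : ℝ → E d,
        LipschitzOnWith (C * nndist x y) c (Icc 0 1) ∧ (∀ t ∈ Icc (0 : ℝ) 1, c t ∈ closure Ω) ∧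
        c 0 = x ∧ c 1 = y := by
    by_cases hx₀ : (x₀ : E d) ∈ Ω
    · obtain ⟨ρ, hρ, hball⟩ := Metric.isOpen_iff.1 hopen _ hx₀
      refine ⟨ρ, hρ, 1, fun x hx y hy => ⟨fun t => x + t • (y - x), ?_, fun t ht =>
        subset_closure (hball ((convex_ball _ ρ).add_smul_sub_mem hx.2 hy.2 ht)), by simp,
        by simp⟩⟩
      refine LipschitzOnWith.of_dist_le_mul fun a _ b _ => le_of_eq ?_
      rw [dist_eq_norm, add_sub_add_left_eq_sub, ← sub_smul, norm_smul, Real.dist_eq,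
        Real.norm_eq_abs, ← dist_eq_norm, dist_comm y x]
      push_cast
      ring
    · obtain ⟨e, r, γ, h⟩ := hC1 x₀ ⟨x₀.2, by rwa [hopen.interior_eq]⟩
      exact h.exists_curve
  obtain ⟨ρ, hρ, C, h⟩ := hcurve
  refine ⟨ρ, hρ, C, C.2, fun x hx y hy ε hε => ?_⟩
  obtain ⟨c, hc, hmem, h0, h1⟩ := h x ⟨x.2, hx⟩ y ⟨y.2, hy⟩
  have := stepBound_of_lipschitzOnWith hε hc hmem h0 h1
  push_cast at this
  exact this

/-- A vector with a positive component along the outer normal points out of the domain, uniformly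
near the boundary point. -/
lemma exists_inward_segment {Ω : Set (E d)} {x₀ ν n : E d} (hν : IsOuterNormal Ω x₀ ν)
    (hn : 0 < ⟪n, ν⟫) : ∃ ρ > 0, ∀ x ∈ closure Ω, dist x x₀ < ρ → ∀ v, dist v n < ρ →
      ∀ t, 0 ≤ t → t < ρ → x - t • v ∈ closure Ω := by
  obtain ⟨e, r, γ, h, rfl⟩ := hν
  obtain ⟨he, hr, hγ, -⟩ := id h
  have hG := contDiff_graphFun e hγ
  set G := graphFun e γ
  have hgrad : 0 < fderiv ℝ G x₀ n := by
    have h1 : ⟪∇ G x₀, n⟫ = fderiv ℝ G x₀ n := by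
      simp [gradient]
    rw [inner_smul_right] at hn
    rw [← h1, real_inner_comm]
    exact pos_of_mul_pos_right hn (by positivity)
  -- Strict differentiability controls the increment of G between two arbitrary points near x₀,
  -- which makes the descent along -v uniform in x. The error constant `c` is such that c t ‖v‖ ≤ t
  -- a/2, while the linear term gains more than t a/2.
  have hstrict : HasStrictFDerivAt G (fderiv ℝ G x₀) x₀ :=
    hG.contDiffAt.hasStrictFDerivAt one_ne_zero
  set a := fderiv ℝ G x₀ n
  set c := a / (2 * (‖n‖ + 1))
  have hc : 0 < c := by positivity
  have hc' : c * (‖n‖ + 1) = a / 2 := by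
    simp only [c]; field_simp
  obtain ⟨ρ₁, hρ₁, h1⟩ := Metric.eventually_nhds_iff.1 (hstrict.isLittleO.def hc)
  have hcont : ContinuousAt (fun v => fderiv ℝ G x₀ v) n :=
    (fderiv ℝ G x₀).continuous.continuousAt
  obtain ⟨ρ₂, hρ₂, h2⟩ := Metric.eventually_nhds_iff.1
    (hcont.eventually (lt_mem_nhds (half_lt_self hgrad)))
  set ρ₀ := min ρ₁ r
  have hρ₀ : 0 < ρ₀ := by positivity
  set ρ := min (min ρ₂ 1) (ρ₀ / (2 * (‖n‖ + 1)))
  have hρ : 0 < ρ := by positivity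
  have hρ3 : ρ * (‖n‖ + 1) ≤ ρ₀ / 2 := by
    have : ρ ≤ ρ₀ / (2 * (‖n‖ + 1)) := min_le_right _ _
    rw [le_div_iff₀ (by positivity)] at this
    linarith
  have hρρ : ρ ≤ ρ₀ / 2 := by nlinarith [norm_nonneg n]
  refine ⟨ρ, hρ, fun x hx hxx v hv t ht htρ => ?_⟩
  have hvn : ‖v‖ ≤ ‖n‖ + 1 := by
    have := norm_sub_norm_le v n
    rw [← dist_eq_norm] at this
    have : ρ ≤ 1 := (min_le_left _ _).trans (min_le_right _ _)
    linarith
  have hxρ : dist x x₀ < ρ₀ := by linarith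
  have hdist : dist (x - t • v) x₀ < ρ₀ := by
    have h3 : dist (x - t • v) x ≤ ρ * (‖n‖ + 1) := by
      rw [dist_eq_norm, sub_sub_cancel_left, norm_neg, norm_smul, Real.norm_of_nonneg ht]
      gcongr
    linarith [dist_triangle (x - t • v) x x₀]
  rw [h.mem_closure_iff (hdist.trans_le (min_le_right _ _))]
  have hGx := (h.mem_closure_iff (Metric.mem_ball.2 (hxρ.trans_le (min_le_right _ _)))).1 hx
  have h4 := h1 (y := (x - t • v, x)) (by
    rw [Prod.dist_eq]
    exact max_lt (hdist.trans_le (min_le_left _ _)) (hxρ.trans_le (min_le_left _ _)))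
  simp only [sub_sub_cancel_left, map_neg, map_smul, norm_neg, norm_smul, smul_eq_mul,
    Real.norm_eq_abs, abs_of_nonneg ht] at h4
  have h5 := h2 (hv.trans_le ((min_le_left _ _).trans (min_le_left _ _)))
  have h6 := (abs_le.1 h4).2
  have h7 : c * (t * ‖v‖) ≤ t * (a / 2) := by
    rw [← hc']; nlinarith [mul_le_mul_of_nonneg_left hvn (mul_nonneg hc.le ht)]
  have h8 := mul_le_mul_of_nonneg_left h5.le ht
  change G (x - t • v) ≤ 0
  change G x ≤ 0 at hGx
  linarith

/-! ### Limits of value functions -/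

/-- `u` is a uniform limit, for small step sizes, of functions that almost satisfy the rescaled
dynamic programming equation of the tug-of-war game. -/
def IsGameLimit (Ω : Set (E d)) (f u : closure Ω → ℝ) : Prop :=
  ∀ η > 0, ∃ ε > 0, ε < η ∧ ∃ w : closure Ω → ℝ, (∃ B, ∀ x, |w x| ≤ B) ∧
    (∀ x, |w x - u x| ≤ η) ∧
    ∀ x, |w x - midrange (epsAdj (closure Ω) ε) w x - ε ^ 2 / 2 * f x| ≤ η * ε ^ 2

lemma IsGameLimit.neg {Ω : Set (E d)} {f u : closure Ω → ℝ} (h : IsGameLimit Ω f u) :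
    IsGameLimit Ω (fun x => -f x) (fun x => -u x) := by
  intro η hη
  obtain ⟨ε, hε, hεη, w, ⟨B, hB⟩, hw, heq⟩ := h η hη
  refine ⟨ε, hε, hεη, fun x => -w x, ⟨B, fun x => by rw [abs_neg]; exact hB x⟩, fun x => ?_,
    fun x => ?_⟩
  · rw [← abs_neg]; convert hw x using 2; ring
  · rw [midrange_neg, ← abs_neg]; convert heq x using 2; ring

/-- An asymptotic version of the Arzelà-Ascoli theorem: functions that are Lipschitz above the
scale `ε` converge uniformly along an ultrafilter. -/
lemma exists_uniform_limit {X : Type*} [MetricSpace X] [CompactSpace X] {𝒰 : Ultrafilter ℝ}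
    (h𝒰 : (𝒰 : Filter ℝ) ≤ 𝓝 0) {w : ℝ → X → ℝ} {R M L : ℝ} (hL : 0 ≤ L)
    (hR : ∀ᶠ ε in (𝒰 : Filter ℝ), ∀ x, |w ε x| ≤ R)
    (hw : ∀ᶠ ε in (𝒰 : Filter ℝ), ∀ x y, |w ε x - w ε y| ≤ L * dist x y + M * ε) :
    ∃ u : X → ℝ, LipschitzWith L.toNNReal u ∧
      ∀ η > 0, ∀ᶠ ε in (𝒰 : Filter ℝ), ∀ x, |w ε x - u x| ≤ η := by
  have hlim : ∀ x, ∃ a, Tendsto (fun ε => w ε x) 𝒰 (𝓝 a) := by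
    intro x
    -- An ultrafilter converges on a compact interval, so all pointwise limits exist at once and no
    -- diagonal subsequence is required.
    obtain ⟨a, -, ha⟩ := (isCompact_Icc (a := -R) (b := R)).ultrafilter_le_nhds
      (𝒰.map fun ε => w ε x)
      (le_principal_iff.2 (hR.mono fun ε h => abs_le.1 (h x)))
    exact ⟨a, ha⟩
  choose u hu using hlim
  have hM : Tendsto (fun ε : ℝ => M * ε) 𝒰 (𝓝 0) := by
    have h1 : Tendsto (fun ε : ℝ => M * ε) (𝓝 0) (𝓝 (M * 0)) := tendsto_id.const_mul M
    rw [mul_zero] at h1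
    exact h1.mono_left h𝒰
  have hlip : ∀ x y, |u x - u y| ≤ L * dist x y := by
    intro x y
    have h1 := ((hu x).sub (hu y)).abs
    have h2 : Tendsto (fun ε => L * dist x y + M * ε) 𝒰 (𝓝 (L * dist x y + 0)) :=
      tendsto_const_nhds.add hM
    rw [add_zero] at h2
    exact le_of_tendsto_of_tendsto h1 h2 (hw.mono fun ε h => h x y)
  refine ⟨u, LipschitzWith.of_dist_le_mul fun x y => ?_, fun η hη => ?_⟩
  · rw [Real.dist_eq, Real.coe_toNNReal _ hL]
    exact hlip x y
  suffices h : ∀ᶠ ε in (𝒰 : Filter ℝ), ∀ x ∈ (univ : Set X), |w ε x - u x| ≤ η from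
    h.mono fun ε h x => h x trivial
  refine isCompact_univ.induction_on
    (p := fun s => ∀ᶠ ε in (𝒰 : Filter ℝ), ∀ x ∈ s, |w ε x - u x| ≤ η) (by simp) ?_ ?_ ?_
  · exact fun s t hst h => h.mono fun ε h x hx => h x (hst hx)
  · intro s t h h'
    filter_upwards [h, h'] with ε h h'
    rintro x (hx | hx)
    exacts [h x hx, h' x hx]
  · intro x₀ _
    have hδ : 0 < η / (4 * (2 * L + 1)) := by positivity
    refine ⟨Metric.ball x₀ (η / (4 * (2 * L + 1))), ?_, ?_⟩
    · rw [nhdsWithin_univ]; exact Metric.ball_mem_nhds _ hδ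
    filter_upwards [hw, hM.eventually (gt_mem_nhds (by positivity : (0 : ℝ) < η / 4)),
      (hu x₀).eventually (Metric.ball_mem_nhds _ (by positivity : (0 : ℝ) < η / 4))]
      with ε h1 h2 h3 x hx
    have h4 : (2 * L + 1) * dist x x₀ ≤ η / 4 := by
      have := (Metric.mem_ball.1 hx).le
      rw [le_div_iff₀ (by positivity)] at this
      linarith
    have h5 := abs_le.1 (h1 x x₀)
    have h6 := abs_le.1 (hlip x x₀)
    have h7 := abs_lt.1 (Metric.mem_ball.1 h3)
    have h8 := dist_nonneg (x := x) (y := x₀)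
    rw [abs_le]
    constructor <;> linarith

/-- If the long term advantage vanishes in the limit of small step sizes, the rescaled value
functions have a limit, with a Lipschitz constant that depends only on the domain and on the bound
of the running payoff. -/
theorem exists_isGameLimit {Ω : Set (E d)} (hopen : IsOpen Ω) (hconn : IsConnected Ω)
    (hbdd : Bornology.IsBounded Ω) (hC1 : HasC1Boundary Ω) :
    ∃ L : ℝ → ℝ≥0, ∀ f : closure Ω → ℝ, Continuous f → IsLimitAdvantage f 0 →
      ∃ u : closure Ω → ℝ, LipschitzWith (L (⨆ x : closure Ω, |f x|)) u ∧ IsGameLimit Ω f u := by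
  have hcomp : CompactSpace (closure Ω) :=
    isCompact_iff_compactSpace.1 hbdd.isCompact_closure
  have hne : Nonempty (closure Ω) := hconn.nonempty.closure.to_subtype
  obtain ⟨C, hC, hstep⟩ := exists_stepBound hopen hconn hbdd hC1
  obtain ⟨D, hD⟩ := Metric.isBounded_iff.1 (isCompact_univ (X := closure Ω)).isBounded
  replace hD : ∀ x y : closure Ω, dist x y ≤ D := fun x y => hD trivial trivial
  obtain ⟨o⟩ := id hne
  have hD0 : 0 ≤ D := dist_nonneg.trans (hD o o)
  -- With diameter bound (C D + 1)/ε, the edge increments 24 k (2F + 1), multiplied by ε²/2, become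
  -- M ε for the M below. Two points are C·dist/ε + 1 edges apart, which gives M C·dist + M ε.
  refine ⟨fun F => (12 * (C * D + 1) * (2 * F + 1) * C).toNNReal, fun f hf hlim => ?_⟩
  set F := ⨆ x : closure Ω, |f x|
  have hF : ∀ x, |f x| ≤ F := le_ciSup (isCompact_range hf.abs).bddAbove
  have hF0 : 0 ≤ F := (abs_nonneg _).trans (hF o)
  set M := 12 * (C * D + 1) * (2 * F + 1) with hM
  have hM0 : 0 ≤ M := by positivity
  have hsol : ∀ ε : ℝ, 0 < ε → ε ≤ 1 → ∃ w : closure Ω → ℝ, w o = 0 ∧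
      (∀ x y, |w x - w y| ≤ M * C * dist x y + M * ε) ∧
      ∀ x, |w x - midrange (epsAdj (closure Ω) ε) w x - ε ^ 2 / 2 * f x| ≤
        (|longTermAdvantage (epsAdj (closure Ω) ε) f| + ε) * ε ^ 2 := by
    intro ε hε hε1
    have hrefl := epsAdj_refl (closure Ω) ε
    have hk : 1 ≤ (C * D + 1) / ε := by
      rw [le_div_iff₀ hε]
      nlinarith [mul_nonneg hC hD0]
    obtain ⟨u, B, hu, heq, hslope⟩ := exists_approx_solution hrefl (epsAdj_symm _ ε) hk
      (fun x y => (hstep x y ε hε hε1).mono hrefl (by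
        rw [div_add_one hε.ne']
        have := mul_le_mul_of_nonneg_left (hD x y) hC
        gcongr)) hF hε
    refine ⟨fun x => ε ^ 2 / 2 * (u x - u o), by simp, fun x y => ?_, fun x => ?_⟩
    · have h1 := hstep x y ε hε hε1 u _ hslope
      rw [← mul_sub, sub_sub_sub_cancel_right, abs_mul, abs_of_pos (by positivity)]
      refine (mul_le_mul_of_nonneg_left h1 (by positivity)).trans (le_of_eq ?_)
      rw [hM]
      field_simp
      ring
    · rw [midrange_mul_sub hrefl (by positivity) hu]
      have h1 := heq x
      have h2 : ε ^ 2 / 2 * (u x - u o) -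
          ε ^ 2 / 2 * (midrange (epsAdj (closure Ω) ε) u x - u o) - ε ^ 2 / 2 * f x =
          -(ε ^ 2 / 2) * ((f x + midrange (epsAdj (closure Ω) ε) u x - u x -
            longTermAdvantage (epsAdj (closure Ω) ε) f) +
            longTermAdvantage (epsAdj (closure Ω) ε) f) := by ring
      rw [h2, abs_mul, abs_neg, abs_of_pos (by positivity : (0 : ℝ) < ε ^ 2 / 2)]
      have h3 := (abs_add_le _ _).trans
        (add_le_add_left h1 |longTermAdvantage (epsAdj (closure Ω) ε) f|)
      have h4 : 0 ≤ (ε ^ 2 / 2) * (ε + |longTermAdvantage (epsAdj (closure Ω) ε) f|) := by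
        positivity
      linarith [mul_le_mul_of_nonneg_left h3 (by positivity : (0 : ℝ) ≤ ε ^ 2 / 2)]
  choose! w hwo hw heq using hsol
  let 𝒰 : Ultrafilter ℝ := Ultrafilter.of (𝓝[>] 0)
  have h𝒰 : (𝒰 : Filter ℝ) ≤ 𝓝[>] 0 := Ultrafilter.of_le _
  have hpos : ∀ᶠ ε in (𝒰 : Filter ℝ), 0 < ε := h𝒰 self_mem_nhdsWithin
  have hsmall : ∀ {η : ℝ}, 0 < η → ∀ᶠ ε in (𝒰 : Filter ℝ), ε < η := fun hη =>
    (h𝒰.trans nhdsWithin_le_nhds) (gt_mem_nhds hη)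
  have hw' : ∀ᶠ ε in (𝒰 : Filter ℝ), ∀ x y, |w ε x - w ε y| ≤ M * C * dist x y + M * ε := by
    filter_upwards [hpos, hsmall one_pos] with ε h0 h1 using hw ε h0 h1.le
  have hR : ∀ᶠ ε in (𝒰 : Filter ℝ), ∀ x, |w ε x| ≤ M * C * D + M := by
    filter_upwards [hpos, hsmall one_pos] with ε h0 h1 x
    have h2 := hw ε h0 h1.le x o
    rw [hwo ε h0 h1.le, sub_zero] at h2
    refine h2.trans (add_le_add ?_ ?_)
    · exact mul_le_mul_of_nonneg_left (hD x o) (by positivity)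
    · nlinarith
  obtain ⟨u, hlip, hunif⟩ := exists_uniform_limit (h𝒰.trans nhdsWithin_le_nhds)
    (by positivity) hR hw'
  refine ⟨u, hlip, fun η hη => ?_⟩
  have hadv : ∀ᶠ ε in (𝒰 : Filter ℝ),
      |longTermAdvantage (epsAdj (closure Ω) ε) f| < η / 2 := by
    have h1 := hlim.abs
    rw [abs_zero] at h1
    exact h𝒰 (h1.eventually (gt_mem_nhds (half_pos hη)))
  obtain ⟨ε, h0, h1, h2, h3, h4⟩ := (hpos.and ((hsmall one_pos).and
    ((hsmall (half_pos hη)).and (hadv.and (hunif η hη))))).exists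
  refine ⟨ε, h0, h2.trans (half_lt_self hη), w ε, ⟨M * C * D + M * ε, fun x => ?_⟩, h4,
    fun x => (heq ε h0 h1.le x).trans ?_⟩
  · have h5 := hw ε h0 h1.le x o
    rw [hwo ε h0 h1.le, sub_zero] at h5
    refine h5.trans ?_
    gcongr
    exact hD x o
  · gcongr
    linarith

/-! ### Test functions -/

lemma inner_gradient_eq (φ : E d → ℝ) (x v : E d) : ⟪∇ φ x, v⟫ = fderiv ℝ φ x v := by
  simp [gradient]

lemma hasStrictFDerivAt_fderiv {φ : E d → ℝ} {x : E d} (h : ContDiffAt ℝ ∞ φ x) :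
    HasStrictFDerivAt (fderiv ℝ φ) (fderiv ℝ (fderiv ℝ φ) x) x :=
  (h.fderiv_right (m := 1) (by norm_cast)).hasStrictFDerivAt one_ne_zero

/-- Taylor expansion of second order, uniform near a point. -/
lemma exists_taylor_bound {φ : E d → ℝ} {x₀ : E d} (h : ContDiffAt ℝ ∞ φ x₀) {η : ℝ}
    (hη : 0 < η) : ∃ ρ > 0, ∀ x v, dist x x₀ < ρ → dist (x + v) x₀ < ρ →
      |φ (x + v) - φ x - fderiv ℝ φ x v - hess φ x₀ v / 2| ≤ η * ‖v‖ ^ 2 := by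
  obtain ⟨ρ₁, hρ₁, h1⟩ := Metric.eventually_nhds_iff.1
    ((hasStrictFDerivAt_fderiv h).isLittleO.def hη)
  have hdiff : ∀ᶠ x in 𝓝 x₀, DifferentiableAt ℝ φ x :=
    ((h.of_le (m := 1) (by exact_mod_cast le_top)).eventually (by simp)).mono
      fun x hx => hx.differentiableAt one_ne_zero
  obtain ⟨ρ₂, hρ₂, h2⟩ := Metric.eventually_nhds_iff.1 hdiff
  refine ⟨min ρ₁ ρ₂, by positivity, fun x v hx hxv => ?_⟩
  set H := fderiv ℝ (fderiv ℝ φ) x₀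
  have hseg : ∀ t ∈ Icc (0 : ℝ) 1, dist (x + t • v) x₀ < min ρ₁ ρ₂ := by
    intro t ht
    have := (convex_ball x₀ (min ρ₁ ρ₂)).add_smul_sub_mem hx hxv ht
    simpa using this
  -- The Hessian is frozen at x₀. The derivative of the remainder along the segment is then the
  -- strict differentiability error of the first derivative, which is uniform in x; the mean value
  -- inequality concludes.
  have hderiv : ∀ t ∈ Icc (0 : ℝ) 1,
      HasDerivWithinAt (fun t : ℝ => φ (x + t • v) - t * fderiv ℝ φ x v - t ^ 2 / 2 * H v v)
        ((fderiv ℝ φ (x + t • v) - fderiv ℝ φ x - H (t • v)) v) (Icc 0 1) t := by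
    intro t ht
    have h3 : HasDerivAt (fun t : ℝ => x + t • v) v t := by
      simpa using ((hasDerivAt_id t).smul_const v).const_add x
    have h4 := (h2 ((hseg t ht).trans_le (min_le_right _ _))).hasFDerivAt.comp_hasDerivAt t h3
    have h5 := (hasDerivAt_id t).mul_const (fderiv ℝ φ x v)
    have h6 := (((hasDerivAt_id t).pow 2).div_const 2).mul_const (H v v)
    refine ((h4.sub h5).sub h6).hasDerivWithinAt.congr_deriv ?_
    simp
  have hbound : ∀ t ∈ Ico (0 : ℝ) 1,
      ‖(fderiv ℝ φ (x + t • v) - fderiv ℝ φ x - H (t • v)) v‖ ≤ η * ‖v‖ ^ 2 := by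
    intro t ht
    have h3 := h1 (y := (x + t • v, x)) (by
      rw [Prod.dist_eq]
      exact max_lt ((hseg t (Ico_subset_Icc_self ht)).trans_le (min_le_left _ _))
        (hx.trans_le (min_le_left _ _)))
    simp only [add_sub_cancel_left] at h3
    refine (ContinuousLinearMap.le_opNorm _ _).trans ?_
    rw [norm_smul, Real.norm_of_nonneg ht.1] at h3
    have h4 : η * (t * ‖v‖) ≤ η * ‖v‖ := by
      gcongr
      exact mul_le_of_le_one_left (norm_nonneg _) ht.2.le
    nlinarith [norm_nonneg v]
  have key := norm_image_sub_le_of_norm_deriv_le_segment_01' hderiv hbound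
  rw [Real.norm_eq_abs] at key
  convert key using 2
  simp [hess, H]
  ring

lemma hess_smul (φ : E d → ℝ) (x v : E d) (t : ℝ) : hess φ x (t • v) = t ^ 2 * hess φ x v := by
  simp only [hess, map_smul, _root_.smul_apply, smul_eq_mul]
  ring

lemma hess_le_sSup_mul (φ : E d → ℝ) (x v : E d) :
    hess φ x v ≤ sSup (hess φ x '' {v : E d | ‖v‖ = 1}) * ‖v‖ ^ 2 := by
  rcases eq_or_ne v 0 with rfl | hv
  · simp [hess]
  have hv0 : 0 < ‖v‖ := norm_pos_iff.2 hv
  have hbdd : BddAbove (hess φ x '' {v : E d | ‖v‖ = 1}) := by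
    refine ⟨‖fderiv ℝ (fderiv ℝ φ) x‖, ?_⟩
    rintro _ ⟨w, hw, rfl⟩
    have hw : ‖w‖ = 1 := hw
    refine (le_abs_self _).trans (((fderiv ℝ (fderiv ℝ φ) x).le_opNorm₂ w w).trans ?_)
    rw [hw, mul_one, mul_one]
  have h1 : hess φ x (‖v‖⁻¹ • v) ≤ _ :=
    le_csSup hbdd ⟨‖v‖⁻¹ • v, by simp [norm_smul, hv0.ne'], rfl⟩
  rw [hess_smul] at h1
  calc hess φ x v = ‖v‖⁻¹ ^ 2 * hess φ x v * ‖v‖ ^ 2 := by field_simp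
    _ ≤ _ := by gcongr

lemma upperInfLaplacian_of_ne {φ : E d → ℝ} {x : E d} (h : ∇ φ x ≠ 0) :
    upperInfLaplacian φ x = hess φ x (‖∇ φ x‖⁻¹ • ∇ φ x) := by
  rw [upperInfLaplacian, if_pos h, hess_smul]

/-- A linear function with a quadratic perturbation is almost maximized on a small ball in the
direction of its gradient. -/
lemma inner_add_quadratic_le (H : E d →L[ℝ] E d →L[ℝ] ℝ) {n w : E d} {g g₀ ε : ℝ} (hn : ‖n‖ = 1)
    (hε : 0 < ε) (hw : ‖w‖ ≤ ε) (hg₀ : 0 < g₀) (hg : g₀ ≤ g) :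
    g * ⟪n, w⟫ + H w w / 2 ≤ g * ε + ε ^ 2 * H n n / 2 + ‖H‖ ^ 2 * ε ^ 3 / g₀ := by
  set s := ‖w - ε • n‖
  -- A deviation s from ε n costs at least g₀ s²/(2ε) in the linear term and gains at most ‖H‖ ε s
  -- in the quadratic one; completing the square leaves an error of order ε³.
  have hs : s ^ 2 ≤ 2 * ε * (ε - ⟪n, w⟫) := by
    rw [norm_sub_sq_real, inner_smul_right, norm_smul, hn, Real.norm_of_nonneg hε.le,
      real_inner_comm]
    nlinarith [norm_nonneg w]
  have h1 : H w w - ε ^ 2 * H n n = H (w - ε • n) w + H (ε • n) (w - ε • n) := by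
    simp only [map_sub, map_smul, _root_.sub_apply, _root_.smul_apply,
      smul_eq_mul]
    ring
  have h2 : H (w - ε • n) w ≤ ‖H‖ * s * ε :=
    (le_abs_self _).trans ((H.le_opNorm₂ _ _).trans (by gcongr))
  have h3 : H (ε • n) (w - ε • n) ≤ ‖H‖ * ε * s := by
    refine (le_abs_self _).trans ((H.le_opNorm₂ _ _).trans (le_of_eq ?_))
    rw [norm_smul, hn, Real.norm_of_nonneg hε.le, mul_one]
  have h4 : 0 ≤ ε - ⟪n, w⟫ := by
    have := real_inner_le_norm n w
    rw [hn, one_mul] at this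
    linarith
  have h5 : g₀ * (ε - ⟪n, w⟫) ≤ g * (ε - ⟪n, w⟫) := by gcongr
  have h6 : ‖H‖ * ε * s ≤ g₀ * (ε - ⟪n, w⟫) + ‖H‖ ^ 2 * ε ^ 3 / g₀ := by
    have h7 : g₀ * (s ^ 2 / (2 * ε)) ≤ g₀ * (ε - ⟪n, w⟫) := by
      gcongr
      rw [div_le_iff₀ (by positivity)]
      linarith
    have h8 : g₀ * (s ^ 2 / (2 * ε)) + ‖H‖ ^ 2 * ε ^ 3 / g₀ - ‖H‖ * ε * s =
        ((g₀ * s - ‖H‖ * ε ^ 2) ^ 2 + ‖H‖ ^ 2 * ε ^ 4) / (2 * ε * g₀) := by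
      field_simp
      ring
    have h9 : 0 ≤ ((g₀ * s - ‖H‖ * ε ^ 2) ^ 2 + ‖H‖ ^ 2 * ε ^ 4) / (2 * ε * g₀) := by positivity
    linarith
  linarith

lemma epsAdj_of_segment {A : Set (E d)} {ε : ℝ} {x y : A}
    (h : ∀ t ∈ Icc (0 : ℝ) 1, (x : E d) + t • ((y : E d) - x) ∈ A) (hε : dist x y ≤ ε) :
    epsAdj A ε x y := by
  refine epsAdj_of_lipschitzOnWith (c := fun t => (x : E d) + t • ((y : E d) - (x : E d)))
    (K := nndist x y) ?_ h hε (by simp) (by simp)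
  refine LipschitzOnWith.of_dist_le_mul fun a _ b _ => le_of_eq ?_
  rw [dist_eq_norm, add_sub_add_left_eq_sub, ← sub_smul, norm_smul, Real.dist_eq,
    Real.norm_eq_abs, ← dist_eq_norm, dist_comm (y : E d) x, mul_comm]
  rfl

/-! ### Viscosity properties of limits of value functions -/

/-- At a touching point, the test function almost satisfies the inequality that corresponds to the
dynamic programming equation. -/
lemma IsGameLimit.exists_touching {Ω : Set (E d)} {f u : closure Ω → ℝ} (h : IsGameLimit Ω f u)
    (hcomp : IsCompact (closure Ω)) (hf : Continuous f) (hu : Continuous u) {φ : E d → ℝ}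
    (hφ : ContinuousOn φ (closure Ω)) {x₀ : closure Ω}
    (hmax : ∀ᶠ y in 𝓝[≠] x₀, u y - φ y < u x₀ - φ x₀) {ρ : ℝ} (hρ : 0 < ρ) :
    ∃ ε > 0, ε < ρ ∧ ∃ x : closure Ω, dist x x₀ < ρ ∧ ∃ y : closure Ω, dist y x ≤ ε ∧
      ∀ z, epsAdj (closure Ω) ε x z → -(ε ^ 2 * (f x₀ + ρ)) ≤ φ y + φ z - 2 * φ x := by
  have : CompactSpace (closure Ω) := isCompact_iff_compactSpace.1 hcomp
  have hφ' : Continuous fun x : closure Ω => φ x := continuousOn_iff_continuous_domRestrict.1 hφ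
  obtain ⟨r, hr, hmax⟩ := Metric.eventually_nhds_iff.1 (eventually_nhdsWithin_iff.1 hmax)
  obtain ⟨ρ₁, hρ₁, hf1⟩ := Metric.eventually_nhds_iff.1
    (hf.continuousAt.eventually (gt_mem_nhds (by linarith : f x₀ < f x₀ + ρ / 2)))
  set ρ' := min (min ρ ρ₁) (r / 4)
  have hρ' : 0 < ρ' := by positivity
  obtain ⟨κ, hκ, hK⟩ : ∃ κ > 0, ∀ y : closure Ω, ρ' ≤ dist y x₀ → dist y x₀ ≤ r / 2 →
      u y - φ y ≤ u x₀ - φ x₀ - κ := by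
    have hKc : IsCompact {y : closure Ω | ρ' ≤ dist y x₀ ∧ dist y x₀ ≤ r / 2} :=
      ((isClosed_le continuous_const (continuous_id.dist continuous_const)).inter
        (isClosed_le (continuous_id.dist continuous_const) continuous_const)).isCompact
    rcases eq_empty_or_nonempty {y : closure Ω | ρ' ≤ dist y x₀ ∧ dist y x₀ ≤ r / 2} with he | hne
    · exact ⟨1, one_pos, fun y h1 h2 => (he.subset ⟨h1, h2⟩ : y ∈ (∅ : Set _)).elim⟩
    · obtain ⟨y, ⟨hy1, hy2⟩, hy⟩ := hKc.exists_isMaxOn hne (hu.sub hφ').continuousOn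
      refine ⟨(u x₀ - φ x₀) - (u y - φ y), ?_, fun z h1 h2 => ?_⟩
      · have := hmax (y := y) (by linarith) (by
          rintro rfl
          rw [dist_self] at hy1
          linarith)
        linarith
      · have : u z - φ z ≤ u y - φ y := hy ⟨h1, h2⟩
        linarith
  -- κ/4 keeps the approximate maximum of w - φ out of the annulus, ρ/10 absorbs the error 5η at the
  -- end, and r/4 keeps neighbours of x inside the ball of radius r/2.
  set η := min (min (κ / 4) (ρ / 10)) (min 1 (min ρ (r / 4)))
  have hη : 0 < η := by positivity
  have hη1 : η ≤ κ / 4 := (min_le_left _ _).trans (min_le_left _ _)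
  have hη2 : η ≤ ρ / 10 := (min_le_left _ _).trans (min_le_right _ _)
  have hη3 : η ≤ 1 := (min_le_right _ _).trans (min_le_left _ _)
  have hη4 : η ≤ ρ := (min_le_right _ _).trans ((min_le_right _ _).trans (min_le_left _ _))
  have hη5 : η ≤ r / 4 := (min_le_right _ _).trans ((min_le_right _ _).trans (min_le_right _ _))
  obtain ⟨ε, hε, hεη, w, ⟨B, hB⟩, hwu, heq⟩ := h η hη
  have hε2 : 0 < η * ε ^ 2 := by positivity
  have hε3 : η * ε ^ 2 ≤ η := mul_le_of_le_one_right hη.le (by nlinarith)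
  -- The function w need not be continuous, so its maximum may not be attained; an error η ε² is
  -- harmless in a second-order estimate.
  obtain ⟨x, hx, hxmax⟩ : ∃ x : closure Ω, dist x x₀ ≤ r / 2 ∧
      ∀ y : closure Ω, dist y x₀ ≤ r / 2 → w y - φ y ≤ w x - φ x + η * ε ^ 2 := by
    obtain ⟨P, hP⟩ := (isCompact_range hφ').bddBelow
    have hbdd : BddAbove (range fun y : {y : closure Ω // dist y x₀ ≤ r / 2} => w y - φ y) := by
      refine ⟨B - P, ?_⟩
      rintro _ ⟨y, rfl⟩
      have := hP ⟨y.1, rfl⟩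
      simp only at this ⊢
      linarith [(abs_le.1 (hB y)).2]
    have : Nonempty {y : closure Ω // dist y x₀ ≤ r / 2} := ⟨⟨x₀, by rw [dist_self]; positivity⟩⟩
    obtain ⟨x, hx⟩ := exists_lt_of_lt_ciSup (sub_lt_self
      (⨆ y : {y : closure Ω // dist y x₀ ≤ r / 2}, (w y - φ y)) hε2)
    refine ⟨x, x.2, fun y hy => ?_⟩
    have := le_ciSup hbdd ⟨y, hy⟩
    simp only at this
    linarith
  have hxρ : dist x x₀ < ρ' := by
    by_contra! hle
    have h1 := hK x hle hx
    have h2 := hxmax x₀ (by rw [dist_self]; positivity)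
    linarith [(abs_le.1 (hwu x)).2, (abs_le.1 (hwu x₀)).1]
  have hnb : ∀ y, epsAdj (closure Ω) ε x y → w y ≤ w x + φ y - φ x + η * ε ^ 2 := by
    intro y hy
    have h1 := dist_le_of_epsAdj hε.le hy
    have h2 : ρ' ≤ r / 4 := min_le_right _ _
    linarith [hxmax y (by linarith [dist_triangle_left y x₀ x])]
  have : Nonempty {y // epsAdj (closure Ω) ε x y} := ⟨⟨x, epsAdj_refl _ _ _⟩⟩
  obtain ⟨⟨y, hy⟩, hy'⟩ := exists_lt_of_lt_ciSup (sub_lt_self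
    (⨆ y : {y // epsAdj (closure Ω) ε x y}, w y) hε2)
  refine ⟨ε, hε, by linarith, x, hxρ.trans_le ((min_le_left _ _).trans (min_le_left _ _)), y, ?_,
    fun z hz => ?_⟩
  · rw [dist_comm]
    exact dist_le_of_epsAdj hε.le hy
  · have h1 := hnb y hy
    have h2 := hnb z hz
    have h3 := iInf_adj_le hB hz
    have h4 := (abs_le.1 (heq x)).2
    have h5 := hf1 (hxρ.trans_le ((min_le_left _ _).trans (min_le_right _ _)))
    -- The five errors η ε²: two from the equation for w, doubled; one each from the near maximality
    -- of x against y and against z; one from the choice of y.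
    have h6 : ε ^ 2 * (f x + 5 * η) ≤ ε ^ 2 * (f x₀ + ρ) :=
      mul_le_mul_of_nonneg_left (by linarith) (sq_nonneg ε)
    unfold midrange at h4
    simp only at hy'
    linarith

/-- The viscosity inequality at points where the gradient of the test function does not vanish and
points out of the domain. -/
lemma IsGameLimit.neg_hess_le {Ω U : Set (E d)} {f u : closure Ω → ℝ} (h : IsGameLimit Ω f u)
    (hcomp : IsCompact (closure Ω)) (hf : Continuous f) (hu : Continuous u) {φ : E d → ℝ}
    (hU : IsOpen U) (hΩU : closure Ω ⊆ U) (hφ : ContDiffOn ℝ ∞ φ U) {x₀ : closure Ω}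
    (hmax : ∀ᶠ y in 𝓝[≠] x₀, u y - φ y < u x₀ - φ x₀) (hgrad : ∇ φ (x₀ : E d) ≠ 0)
    (hin : ∃ ρ > 0, ∀ x ∈ closure Ω, dist x (x₀ : E d) < ρ → ∀ v,
      dist v (‖∇ φ (x₀ : E d)‖⁻¹ • ∇ φ (x₀ : E d)) < ρ →
      ∀ t, 0 ≤ t → t < ρ → x - t • v ∈ closure Ω) :
    -hess φ x₀ (‖∇ φ (x₀ : E d)‖⁻¹ • ∇ φ (x₀ : E d)) ≤ f x₀ := by
  by_contra! hlt
  have hφ₀ : ContDiffAt ℝ ∞ φ x₀ := hφ.contDiffAt (hU.mem_nhds (hΩU x₀.2))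
  -- The direction is the normalized gradient at the moving point x, not at x₀: otherwise the terms
  -- of order ε would not cancel up to o(ε²).
  set n : E d → E d := fun x => ‖∇ φ x‖⁻¹ • ∇ φ x with hn
  set H := fderiv ℝ (fderiv ℝ φ) (x₀ : E d) with hH
  change f x₀ < -H (n x₀) (n x₀) at hlt
  set κ := -H (n x₀) (n x₀) - f x₀ with hκ
  have hκ0 : 0 < κ := by linarith
  set g₀ := ‖∇ φ (x₀ : E d)‖ / 2 with hg₀
  have hg0 : 0 < ‖∇ φ (x₀ : E d)‖ := norm_pos_iff.2 hgrad
  have hgcont : ContinuousAt (∇ φ) (x₀ : E d) :=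
    (InnerProductSpace.toDual ℝ (E d)).symm.continuous.continuousAt.comp
      (hasStrictFDerivAt_fderiv hφ₀).continuousAt
  have hncont : ContinuousAt n (x₀ : E d) := (hgcont.norm.inv₀ hg0.ne').smul hgcont
  obtain ⟨ρ₁, hρ₁, hin⟩ := hin
  obtain ⟨ρ₂, hρ₂, htaylor⟩ := exists_taylor_bound hφ₀ (by positivity : 0 < κ / 8)
  have hHcont : ContinuousAt (fun x => H (n x) (n x)) (x₀ : E d) :=
    (H.continuous.continuousAt.comp hncont).clm_apply hncont
  obtain ⟨ρ₃, hρ₃, hloc⟩ := Metric.eventually_nhds_iff.1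
    ((hgcont.norm.eventually (lt_mem_nhds (half_lt_self hg0))).and
      ((hncont.eventually (Metric.ball_mem_nhds _ hρ₁)).and
        (hHcont.eventually (gt_mem_nhds (by linarith :
          H (n x₀) (n x₀) < H (n x₀) (n x₀) + κ / 8)))))
  set ρ := min (min ρ₁ (ρ₂ / 2)) (min (min ρ₃ (κ / 8)) (κ * g₀ / (8 * (‖H‖ ^ 2 + 1))))
  have hg₀0 : 0 < g₀ := by positivity
  have hρ : 0 < ρ := by positivity
  have hle1 : ρ ≤ ρ₁ := (min_le_left _ _).trans (min_le_left _ _)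
  have hle2 : ρ ≤ ρ₂ / 2 := (min_le_left _ _).trans (min_le_right _ _)
  have hle3 : ρ ≤ ρ₃ := (min_le_right _ _).trans ((min_le_left _ _).trans (min_le_left _ _))
  have hle4 : ρ ≤ κ / 8 := (min_le_right _ _).trans ((min_le_left _ _).trans (min_le_right _ _))
  have hle5 : ‖H‖ ^ 2 * ρ / g₀ ≤ κ / 8 := by
    have : ρ ≤ κ * g₀ / (8 * (‖H‖ ^ 2 + 1)) := (min_le_right _ _).trans (min_le_right _ _)
    rw [le_div_iff₀ (by positivity)] at this
    rw [div_le_iff₀ hg₀0]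
    linarith
  obtain ⟨ε, hε, hερ, x, hx, y, hyx, hz⟩ :=
    h.exists_touching hcomp hf hu (hφ.continuousOn.mono hΩU) hmax hρ
  have hx' : dist (x : E d) x₀ < ρ := hx
  obtain ⟨hgx, hnx, hHx⟩ := hloc (hx'.trans_le hle3)
  have hgx0 : 0 < ‖∇ φ (x : E d)‖ := hg₀0.trans hgx
  have hnorm : ‖n x‖ = 1 := by
    simp [hn, norm_smul, hgx0.ne']
  have hseg : ∀ t, 0 ≤ t → t ≤ ε → (x : E d) - t • n x ∈ closure Ω := fun t h0 h1 =>
    hin x x.2 (hx'.trans_le hle1) _ hnx t h0 (by linarith)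
  have hεn : ‖ε • n x‖ = ε := by rw [norm_smul, hnorm, Real.norm_of_nonneg hε.le, mul_one]
  -- This is the only use of the geometry of the domain: the step against the gradient must stay in
  -- the closure. About y nothing is needed but |y - x| ≤ ε.
  have hadj : epsAdj (closure Ω) ε x ⟨(x : E d) - ε • n x, hseg ε hε.le le_rfl⟩ := by
    refine epsAdj_of_segment (fun t ht => ?_) ?_
    · have := hseg (t * ε) (mul_nonneg ht.1 hε.le) (mul_le_of_le_one_left hε.le ht.2)
      convert this using 1
      module
    · rw [Subtype.dist_eq, dist_eq_norm, sub_sub_cancel, hεn]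
  have hkey := hz _ hadj
  set w := (y : E d) - x with hw
  have hwε : ‖w‖ ≤ ε := by rw [hw, ← dist_eq_norm]; exact hyx
  have hwε2 : ‖w‖ ^ 2 ≤ ε ^ 2 := by gcongr
  have hdist : ∀ v : E d, ‖v‖ ≤ ε → dist ((x : E d) + v) x₀ < ρ₂ := fun v hv => by
    have h1 : dist ((x : E d) + v) x = ‖v‖ := by rw [dist_eq_norm, add_sub_cancel_left]
    linarith [dist_triangle ((x : E d) + v) x x₀]
  have hx2 : dist (x : E d) x₀ < ρ₂ := by linarith
  have ht1 := (abs_le.1 (htaylor x w hx2 (hdist w hwε))).2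
  have ht2 := (abs_le.1 (htaylor x (-(ε • n x)) hx2 (hdist _ (by rw [norm_neg, hεn])))).2
  have hgn : ∇ φ (x : E d) = ‖∇ φ (x : E d)‖ • n x := by
    rw [hn, smul_inv_smul₀ hgx0.ne']
  have hd1 : fderiv ℝ φ x w = ‖∇ φ (x : E d)‖ * ⟪n x, w⟫ := by
    rw [← inner_gradient_eq]
    nth_rewrite 1 [hgn]
    rw [real_inner_smul_left]
  have hd2 : fderiv ℝ φ x (-(ε • n x)) = -(‖∇ φ (x : E d)‖ * ε) := by
    rw [← inner_gradient_eq]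
    nth_rewrite 1 [hgn]
    rw [real_inner_smul_left, inner_neg_right, inner_smul_right, real_inner_self_eq_norm_sq,
      hnorm]
    ring
  have hh2 : hess φ x₀ (-(ε • n x)) = ε ^ 2 * H (n x) (n x) := by
    rw [← neg_smul, hess_smul, neg_sq]
    rfl
  have hquad := inner_add_quadratic_le H hnorm hε hwε hg₀0 hgx.le
  rw [norm_neg, hεn, hd2, hh2, ← sub_eq_add_neg] at ht2
  rw [hd1, show (x : E d) + w = y by rw [hw]; abel] at ht1
  change _ - H w w / 2 ≤ _ at ht1
  -- The step to y gains at most |∇φ(x)| ε to first order, and the step to z loses exactly that.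
  -- Each contributes half of ε² H(n, n), and κ/4 collects the two Taylor errors.
  have hfin : -(ε ^ 2 * (f x₀ + ρ)) ≤
      ε ^ 2 * (H (n x) (n x) + κ / 4) + ‖H‖ ^ 2 * ε ^ 3 / g₀ := by
    have : κ / 8 * ‖w‖ ^ 2 ≤ κ / 8 * ε ^ 2 := by gcongr
    simp only at hkey
    linarith
  have hcube : ‖H‖ ^ 2 * ε ^ 3 / g₀ ≤ ε ^ 2 * (κ / 8) := by
    calc ‖H‖ ^ 2 * ε ^ 3 / g₀ = ε ^ 2 * (‖H‖ ^ 2 * ε / g₀) := by ring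
      _ ≤ ε ^ 2 * (‖H‖ ^ 2 * ρ / g₀) := by gcongr
      _ ≤ ε ^ 2 * (κ / 8) := by gcongr
  have hε2 : 0 < ε ^ 2 := by positivity
  have : 0 ≤ ε ^ 2 * (f x₀ + ρ + H (n x) (n x) + κ / 4 + κ / 8) := by linarith
  have := nonneg_of_mul_nonneg_right this hε2
  linarith

/-- The interior counterpart of `exists_inward_segment`: at an interior point every unit direction
is admissible, so both cases feed the same hypothesis of `IsGameLimit.neg_hess_le`. -/
lemma exists_segment_of_mem {Ω : Set (E d)} (hopen : IsOpen Ω) {x₀ n : E d} (hx₀ : x₀ ∈ Ω)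
    (hn : ‖n‖ = 1) : ∃ ρ > 0, ∀ x ∈ closure Ω, dist x x₀ < ρ → ∀ v, dist v n < ρ →
      ∀ t, 0 ≤ t → t < ρ → x - t • v ∈ closure Ω := by
  obtain ⟨r, hr, hball⟩ := Metric.isOpen_iff.1 hopen _ hx₀
  refine ⟨min 1 (r / 3), by positivity, fun x _ hx v hv t ht htρ => subset_closure (hball ?_)⟩
  have h1 : ‖v‖ ≤ 2 := by
    have := norm_sub_norm_le v n
    rw [← dist_eq_norm] at this
    linarith [hv.trans_le (min_le_left _ _)]
  have h2 : dist (x - t • v) x ≤ r / 3 * 2 := by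
    rw [dist_eq_norm, sub_sub_cancel_left, norm_neg, norm_smul, Real.norm_of_nonneg ht]
    gcongr
    exact htρ.le.trans (min_le_right _ _)
  rw [Metric.mem_ball]
  linarith [dist_triangle (x - t • v) x x₀, hx.trans_le (min_le_right _ _)]

/-- The viscosity inequality at interior points where the gradient of the test function vanishes
and its Hessian has a non-negative eigenvalue. -/
lemma IsGameLimit.neg_sSup_hess_le {Ω U : Set (E d)} {f u : closure Ω → ℝ}
    (h : IsGameLimit Ω f u) (hopen : IsOpen Ω)
    (hcomp : IsCompact (closure Ω)) (hf : Continuous f) (hu : Continuous u) {φ : E d → ℝ}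
    (hU : IsOpen U) (hΩU : closure Ω ⊆ U) (hφ : ContDiffOn ℝ ∞ φ U) {x₀ : closure Ω}
    (hx₀ : (x₀ : E d) ∈ Ω) (hmax : ∀ᶠ y in 𝓝[≠] x₀, u y - φ y < u x₀ - φ x₀)
    (hsup : 0 ≤ sSup (hess φ x₀ '' {v : E d | ‖v‖ = 1})) :
    -sSup (hess φ x₀ '' {v : E d | ‖v‖ = 1}) ≤ f x₀ := by
  have hle := hess_le_sSup_mul φ x₀
  set a := sSup (hess φ x₀ '' {v : E d | ‖v‖ = 1})
  by_contra! hlt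
  have hφ₀ : ContDiffAt ℝ ∞ φ x₀ := hφ.contDiffAt (hU.mem_nhds (hΩU x₀.2))
  set κ := -a - f x₀ with hκ
  have hκ0 : 0 < κ := by linarith
  obtain ⟨r, hr, hball⟩ := Metric.isOpen_iff.1 hopen _ hx₀
  obtain ⟨ρ₂, hρ₂, htaylor⟩ := exists_taylor_bound hφ₀ (by positivity : 0 < κ / 8)
  set ρ := min (min (r / 2) (ρ₂ / 2)) (κ / 8)
  have hρ : 0 < ρ := by positivity
  have hle1 : ρ ≤ r / 2 := (min_le_left _ _).trans (min_le_left _ _)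
  have hle2 : ρ ≤ ρ₂ / 2 := (min_le_left _ _).trans (min_le_right _ _)
  have hle3 : ρ ≤ κ / 8 := min_le_right _ _
  obtain ⟨ε, hε, hερ, x, hx, y, hyx, hz⟩ :=
    h.exists_touching hcomp hf hu (hφ.continuousOn.mono hΩU) hmax hρ
  have hx' : dist (x : E d) x₀ < ρ := hx
  set w := (y : E d) - x with hw
  have hwε : ‖w‖ ≤ ε := by rw [hw, ← dist_eq_norm]; exact hyx
  have hwε2 : ‖w‖ ^ 2 ≤ ε ^ 2 := by gcongr
  have hdist : ∀ v : E d, ‖v‖ ≤ ε → dist ((x : E d) + v) x₀ < 2 * ρ := fun v hv => by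
    have h1 : dist ((x : E d) + v) x = ‖v‖ := by rw [dist_eq_norm, add_sub_cancel_left]
    linarith [dist_triangle ((x : E d) + v) x x₀]
  have hmem : ∀ v : E d, ‖v‖ ≤ ε → (x : E d) + v ∈ closure Ω := fun v hv =>
    subset_closure (hball (Metric.mem_ball.2 (by linarith [hdist v hv])))
  have hwneg : ‖-w‖ ≤ ε := by rwa [norm_neg]
  -- Answering y by its reflection in x cancels the first-order terms exactly, whatever the gradient
  -- at x is.
  have hadj : epsAdj (closure Ω) ε x ⟨(x : E d) + -w, hmem _ hwneg⟩ := by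
    refine epsAdj_of_segment (fun t ht => ?_) ?_
    · rw [add_sub_cancel_left]
      refine hmem _ ?_
      rw [norm_smul, Real.norm_of_nonneg ht.1]
      exact (mul_le_of_le_one_left (norm_nonneg _) ht.2).trans hwneg
    · rw [Subtype.dist_eq, dist_eq_norm, ← norm_neg]
      simpa using hwε
  have hkey := hz _ hadj
  have hx2 : dist (x : E d) x₀ < ρ₂ := by linarith
  have ht1 := (abs_le.1 (htaylor x w hx2 (by linarith [hdist w hwε]))).2
  have ht2 := (abs_le.1 (htaylor x (-w) hx2 (by linarith [hdist _ hwneg]))).2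
  have hneg : hess φ x₀ (-w) = hess φ x₀ w := by
    rw [← neg_one_smul ℝ w, hess_smul]; norm_num
  rw [hneg, map_neg, norm_neg] at ht2
  rw [show (x : E d) + w = y by rw [hw]; abel] at ht1
  -- Here a ≥ 0 is essential: the step w may be shorter than ε, and for a < 0 the inequality would
  -- fail.
  have h1 : hess φ x₀ w ≤ a * ε ^ 2 := (hle w).trans (by gcongr)
  have h2 : κ / 8 * ‖w‖ ^ 2 ≤ κ / 8 * ε ^ 2 := by gcongr
  have hε2 : 0 < ε ^ 2 := by positivity
  have h3 : 0 ≤ ε ^ 2 * (f x₀ + ρ + a + κ / 4) := by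
    simp only at hkey
    linarith
  have := nonneg_of_mul_nonneg_right h3 hε2
  linarith

/-- The gradient of a function is strictly decreasing, in the sense of monotone operators, near a
point where the Hessian is negative definite. -/
lemma exists_fderiv_sub_neg {φ : E d → ℝ} {x₀ : E d} (h : ContDiffAt ℝ ∞ φ x₀)
    (hneg : sSup (hess φ x₀ '' {v : E d | ‖v‖ = 1}) < 0) :
    ∃ ρ > 0, ∀ x y, dist x x₀ < ρ → dist y x₀ < ρ → x ≠ y →
      (fderiv ℝ φ x - fderiv ℝ φ y) (x - y) < 0 := by
  have hle := hess_le_sSup_mul φ x₀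
  set a := sSup (hess φ x₀ '' {v : E d | ‖v‖ = 1})
  obtain ⟨ρ, hρ, h1⟩ := Metric.eventually_nhds_iff.1
    ((hasStrictFDerivAt_fderiv h).isLittleO.def (by linarith : 0 < -a / 2))
  refine ⟨ρ, hρ, fun x y hx hy hxy => ?_⟩
  have h2 := h1 (y := (x, y)) (by rw [Prod.dist_eq]; exact max_lt hx hy)
  simp only at h2
  have h3 := (le_abs_self _).trans (((fderiv ℝ φ x - fderiv ℝ φ y -
    fderiv ℝ (fderiv ℝ φ) x₀ (x - y)).le_opNorm (x - y)).trans
      (mul_le_mul_of_nonneg_right h2 (norm_nonneg _)))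
  rw [_root_.sub_apply] at h3
  have h4 : fderiv ℝ (fderiv ℝ φ) x₀ (x - y) (x - y) ≤ a * ‖x - y‖ ^ 2 := hle (x - y)
  have h5 : 0 < ‖x - y‖ := norm_pos_iff.2 (sub_ne_zero.2 hxy)
  nlinarith [mul_pos (neg_pos.2 hneg) (pow_pos h5 2)]

/-- The derivatives of a function that is perturbed by a linear and a quadratic function. -/
lemma fderiv_perturbed {φ : E d → ℝ} {x : E d} (h : ContDiffAt ℝ ∞ φ x) (l : E d →L[ℝ] ℝ)
    (δ : ℝ) (z : E d) :
    fderiv ℝ (fun y => φ y - l y + δ * ‖y - z‖ ^ 2) x =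
      fderiv ℝ φ x - l + (2 * δ) • innerSL ℝ (x - z) := by
  have h1 : HasFDerivAt φ (fderiv ℝ φ x) x := (h.differentiableAt (by simp)).hasFDerivAt
  have h2 := (((hasFDerivAt_id x).sub_const z).norm_sq).const_mul δ
  refine ((h1.sub l.hasFDerivAt).add h2).fderiv.trans ?_
  ext v
  simp
  ring

lemma hess_perturbed {φ : E d → ℝ} {U : Set (E d)} (hU : IsOpen U) (hφ : ContDiffOn ℝ ∞ φ U)
    {x : E d} (hx : x ∈ U) (l : E d →L[ℝ] ℝ) (δ : ℝ) (z v : E d) :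
    hess (fun y => φ y - l y + δ * ‖y - z‖ ^ 2) x v = hess φ x v + 2 * δ * ‖v‖ ^ 2 := by
  have h0 : fderiv ℝ (fun y => φ y - l y + δ * ‖y - z‖ ^ 2) =ᶠ[𝓝 x]
      fun y => fderiv ℝ φ y - l + (2 * δ) • innerSL ℝ (y - z) := by
    filter_upwards [hU.mem_nhds hx] with y hy
    exact fderiv_perturbed (hφ.contDiffAt (hU.mem_nhds hy)) l δ z
  have h1 : HasFDerivAt (fderiv ℝ φ) (fderiv ℝ (fderiv ℝ φ) x) x :=
    (hasStrictFDerivAt_fderiv (hφ.contDiffAt (hU.mem_nhds hx))).hasFDerivAt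
  let J : E d →L[ℝ] E d →L[ℝ] ℝ := innerSL ℝ
  have h2 : HasFDerivAt (fun y : E d => (2 * δ) • J (y - z)) ((2 * δ) • J) x :=
    (J.hasFDerivAt.comp x ((hasFDerivAt_id x).sub_const z)).const_smul (2 * δ)
  have h3 : HasFDerivAt (fun y => fderiv ℝ φ y - l + (2 * δ) • innerSL ℝ (y - z))
      (fderiv ℝ (fderiv ℝ φ) x + (2 * δ) • J) x :=
    (h1.sub_const l).add h2
  rw [hess, h0.fderiv_eq, h3.fderiv]
  have h4 : J v v = ‖v‖ ^ 2 := real_inner_self_eq_norm_sq v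
  simp only [hess, _root_.add_apply, _root_.smul_apply, smul_eq_mul, h4]

/-- The viscosity inequality at interior points where the gradient of the test function vanishes
and its Hessian is negative definite. A linear perturbation of the test function touches at a point
where the gradient does not vanish. -/
lemma IsGameLimit.neg_sSup_hess_le_of_neg {Ω U : Set (E d)} (hd : 1 ≤ d) {f u : closure Ω → ℝ}
    (h : IsGameLimit Ω f u) (hopen : IsOpen Ω)
    (hcomp : IsCompact (closure Ω)) (hf : Continuous f) (hu : Continuous u) {φ : E d → ℝ}
    (hU : IsOpen U) (hΩU : closure Ω ⊆ U) (hφ : ContDiffOn ℝ ∞ φ U) {x₀ : closure Ω}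
    (hx₀ : (x₀ : E d) ∈ Ω) (hmax : ∀ᶠ y in 𝓝[≠] x₀, u y - φ y < u x₀ - φ x₀)
    (hgrad : ∇ φ (x₀ : E d) = 0) (hneg : sSup (hess φ x₀ '' {v : E d | ‖v‖ = 1}) < 0) :
    -sSup (hess φ x₀ '' {v : E d | ‖v‖ = 1}) ≤ f x₀ := by
  have hcomp' : CompactSpace (closure Ω) := isCompact_iff_compactSpace.1 hcomp
  have hφ₀ : ContDiffAt ℝ ∞ φ x₀ := hφ.contDiffAt (hU.mem_nhds (hΩU x₀.2))
  obtain ⟨r₁, hr₁, hmono⟩ := exists_fderiv_sub_neg hφ₀ hneg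
  have hle := hess_le_sSup_mul φ x₀
  set a := sSup (hess φ x₀ '' {v : E d | ‖v‖ = 1})
  by_contra! hlt
  set κ := -a - f x₀ with hκ
  have hκ0 : 0 < κ := by linarith
  have hgrad' : fderiv ℝ φ (x₀ : E d) = 0 := by
    ext v; rw [← inner_gradient_eq, hgrad]; simp
  have hstrict := hasStrictFDerivAt_fderiv hφ₀
  have hhess : Tendsto (fun x => ‖fderiv ℝ (fderiv ℝ φ) x - fderiv ℝ (fderiv ℝ φ) x₀‖)
      (𝓝 (x₀ : E d)) (𝓝 0) := by
    have hcont := ((hφ₀.fderiv_right (m := 1) (by norm_cast)).fderiv_right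
      (m := 0) (by norm_num)).continuousAt
    simpa using (hcont.sub
      (continuousAt_const (y := fderiv ℝ (fderiv ℝ φ) (x₀ : E d)))).norm.tendsto
  obtain ⟨r₂, hr₂, hhess⟩ := Metric.eventually_nhds_iff.1
    (hhess.eventually (gt_mem_nhds (by positivity : 0 < κ / 4)))
  obtain ⟨r₃, hr₃, hball⟩ := Metric.isOpen_iff.1 hopen _ hx₀
  obtain ⟨r₄, hr₄, hmax⟩ := Metric.eventually_nhds_iff.1 (eventually_nhdsWithin_iff.1 hmax)
  obtain ⟨r₅, hr₅, hf1⟩ := Metric.eventually_nhds_iff.1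
    (hf.continuousAt.eventually (gt_mem_nhds (by linarith : f x₀ < f x₀ + κ / 4)))
  set r := min (min r₁ r₂) (min (min r₃ r₄) r₅) / 2
  have hr : 0 < r := by positivity
  have hrr : 2 * r = min (min r₁ r₂) (min (min r₃ r₄) r₅) := by simp only [r]; ring
  have hle1 : 2 * r ≤ r₁ := hrr.le.trans ((min_le_left _ _).trans (min_le_left _ _))
  have hle2 : 2 * r ≤ r₂ := hrr.le.trans ((min_le_left _ _).trans (min_le_right _ _))
  have hle3 : 2 * r ≤ r₃ :=
    hrr.le.trans ((min_le_right _ _).trans ((min_le_left _ _).trans (min_le_left _ _)))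
  have hle4 : 2 * r ≤ r₄ :=
    hrr.le.trans ((min_le_right _ _).trans ((min_le_left _ _).trans (min_le_right _ _)))
  have hle5 : 2 * r ≤ r₅ := hrr.le.trans ((min_le_right _ _).trans (min_le_right _ _))
  have hφ' : Continuous fun x : closure Ω => φ x :=
    continuousOn_iff_continuous_domRestrict.1 (hφ.continuousOn.mono hΩU)
  have hdcont : Continuous fun x : closure Ω => dist x x₀ := continuous_id.dist continuous_const
  obtain ⟨m, hm, hsphere⟩ : ∃ m > 0, ∀ y : closure Ω, dist y x₀ = r →
      u y - φ y ≤ u x₀ - φ x₀ - m := by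
    have hK : IsCompact {y : closure Ω | dist y x₀ = r} :=
      (isClosed_eq hdcont continuous_const).isCompact
    rcases eq_empty_or_nonempty {y : closure Ω | dist y x₀ = r} with he | hne
    · exact ⟨1, one_pos, fun y h1 => (he.subset h1 : y ∈ (∅ : Set _)).elim⟩
    · obtain ⟨y, hy1, hy⟩ := hK.exists_isMaxOn hne (hu.sub hφ').continuousOn
      have hy1 : dist y x₀ = r := hy1
      refine ⟨(u x₀ - φ x₀) - (u y - φ y), ?_, fun z h1 => ?_⟩
      · have := hmax (y := y) (by linarith) (by
          rintro rfl
          rw [dist_self] at hy1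
          linarith)
        linarith
      · have : u z - φ z ≤ u y - φ y := hy h1
        linarith
  have hsmall : ∀ᶠ y in 𝓝 (x₀ : E d), ‖fderiv ℝ φ y‖ * r < m := by
    have h1 := (hstrict.continuousAt.norm.mul_const r).tendsto
    rw [hgrad', norm_zero, zero_mul] at h1
    exact h1.eventually (gt_mem_nhds hm)
  have : Nonempty (Fin d) := ⟨⟨0, hd⟩⟩
  have hnear : ∀ᶠ y in 𝓝[≠] (x₀ : E d),
      (‖fderiv ℝ φ y‖ * r < m ∧ dist y x₀ < r) ∧ y ≠ x₀ :=
    ((hsmall.and (Metric.ball_mem_nhds (x₀ : E d) hr)).filter_mono nhdsWithin_le_nhds).and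
      self_mem_nhdsWithin
  -- The slope of φ at y' is so small that subtracting it from φ cannot overcome the margin m on the
  -- sphere, so the new maximum point lies inside the ball. A point y' ≠ x₀ exists as d ≥ 1.
  obtain ⟨y', ⟨hy1, hyr⟩, hy3⟩ := hnear.exists
  have hyΩ : y' ∈ closure Ω :=
    subset_closure (hball (Metric.mem_ball.2 (by linarith)))
  set l := fderiv ℝ φ y' with hl
  obtain ⟨z, hzr, hz⟩ := (isClosed_le hdcont continuous_const).isCompact.exists_isMaxOn
    (s := {z : closure Ω | dist z x₀ ≤ r}) ⟨x₀, by simp [hr.le]⟩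
    (f := fun z : closure Ω => u z - (φ z - l z))
    (hu.sub (hφ'.sub (l.continuous.comp continuous_subtype_val))).continuousOn
  replace hz : ∀ y : closure Ω, dist y x₀ ≤ r → u y - (φ y - l y) ≤ u z - (φ z - l z) :=
    fun y hy => hz hy
  have hzr : dist z x₀ < r := by
    refine lt_of_le_of_ne hzr fun heq => ?_
    have h1 := hsphere z heq
    have h2 := hz x₀ (by rw [dist_self]; exact hr.le)
    have h3 : l ((z : E d) - x₀) ≤ ‖l‖ * r := by
      refine (le_abs_self _).trans ((l.le_opNorm _).trans (le_of_eq ?_))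
      rw [← dist_eq_norm, ← Subtype.dist_eq, heq]
    rw [map_sub] at h3
    linarith
  have hzr' : dist (z : E d) x₀ < r := hzr
  have hzΩ : (z : E d) ∈ Ω := hball (Metric.mem_ball.2 (by linarith))
  -- If the perturbed gradient vanished at z, strict monotonicity would force z = y'. Maximality of
  -- z against x₀, with the strictness of the original maximum, then gives l(y' - x₀) > 0, while
  -- monotonicity between y' and x₀ gives l(y' - x₀) < 0.
  by_cases hzy : fderiv ℝ φ (z : E d) = l
  · have hzeq : (z : E d) = y' := by
      by_contra hne
      have := hmono z y' (by linarith) (by linarith) hne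
      rw [hzy, hl, sub_self] at this
      simp at this
    have h1 := hz x₀ (by rw [dist_self]; exact hr.le)
    have h2 := hmono y' x₀ (by linarith) (by rw [dist_self]; exact hr₁) hy3
    rw [hgrad', sub_zero, ← hl, map_sub] at h2
    have h3 := hmax (y := z) (by linarith) (by
      rintro rfl
      exact hy3 hzeq.symm)
    rw [hzeq] at h1 h3
    linarith
  · have hzU : (z : E d) ∈ U := hΩU z.2
    have hφz : ContDiffAt ℝ ∞ φ z := hφ.contDiffAt (hU.mem_nhds hzU)
    -- The quadratic term makes the maximum at z strict and leaves the gradient there unchanged; it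
    -- costs κ/4 in the Hessian. With κ/4 each for the variation of the Hessian and of f, the loss
    -- is 3κ/4 < κ.
    set ψ : E d → ℝ := fun y => φ y - l y + κ / 8 * ‖y - z‖ ^ 2 with hψ
    have hψsmooth : ContDiffOn ℝ ∞ ψ U :=
      (hφ.sub l.contDiff.contDiffOn).add
        (contDiff_const.mul ((contDiff_id.sub contDiff_const).norm_sq ℝ)).contDiffOn
    have hψgrad : ∇ ψ (z : E d) ≠ 0 := by
      intro h0
      refine hzy ?_
      have h1 : fderiv ℝ ψ z = 0 := by
        ext v; rw [← inner_gradient_eq, h0]; simp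
      rw [hψ, fderiv_perturbed hφz, sub_self] at h1
      simpa [sub_eq_zero] using h1
    have hψmax : ∀ᶠ y in 𝓝[≠] z, u y - ψ y < u z - ψ z := by
      have hnear : ∀ᶠ y in 𝓝[≠] z, dist y x₀ < r :=
        mem_nhdsWithin_of_mem_nhds (hdcont.continuousAt.eventually (gt_mem_nhds hzr))
      filter_upwards [hnear, self_mem_nhdsWithin] with y hy hne
      have h1 : 0 < ‖(y : E d) - z‖ :=
        norm_pos_iff.2 (sub_ne_zero.2 fun h => hne (Subtype.ext h))
      have h2 := hz y hy.le
      have h3 : 0 < κ / 8 * ‖(y : E d) - z‖ ^ 2 := by positivity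
      simp only [hψ, sub_self, norm_zero]
      linarith
    have hn : ‖‖∇ ψ (z : E d)‖⁻¹ • ∇ ψ (z : E d)‖ = 1 := by
      simp [norm_smul, hψgrad]
    have key := h.neg_hess_le hcomp hf hu hU hΩU hψsmooth hψmax hψgrad
      (exists_segment_of_mem hopen hzΩ hn)
    set n := ‖∇ ψ (z : E d)‖⁻¹ • ∇ ψ (z : E d)
    rw [hψ, hess_perturbed hU hφ hzU, hn] at key
    have h1 := (hhess (y := z) (by linarith)).le
    have h2 := (le_abs_self _).trans (((fderiv ℝ (fderiv ℝ φ) z -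
      fderiv ℝ (fderiv ℝ φ) x₀).le_opNorm₂ n n))
    rw [hn, mul_one, mul_one, _root_.sub_apply, _root_.sub_apply] at h2
    have h3 := hle n
    rw [hn] at h3
    unfold hess at key h3
    have h4 := hf1 (y := z) (by linarith)
    linarith

/-- Limits of value functions are viscosity subsolutions. -/
theorem IsGameLimit.isViscositySubsolution {Ω : Set (E d)} (hd : 1 ≤ d) (hopen : IsOpen Ω)
    (hcomp : IsCompact (closure Ω)) (hC1 : HasC1Boundary Ω) {f u : closure Ω → ℝ}
    (h : IsGameLimit Ω f u) (hf : Continuous f) (hu : Continuous u) :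
    IsViscositySubsolution Ω f u := by
  refine ⟨hu, fun U φ hU hΩU hφ x₀ hmax => ?_⟩
  by_cases hx₀ : (x₀ : E d) ∈ Ω
  · left
    by_cases hgrad : ∇ φ (x₀ : E d) = 0
    · rw [upperInfLaplacian, if_neg (not_not.2 hgrad)]
      rcases lt_or_ge (sSup (hess φ x₀ '' {v : E d | ‖v‖ = 1})) 0 with hneg | hpos
      · exact h.neg_sSup_hess_le_of_neg hd hopen hcomp hf hu hU hΩU hφ hx₀ hmax hgrad hneg
      · exact h.neg_sSup_hess_le hopen hcomp hf hu hU hΩU hφ hx₀ hmax hpos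
    · rw [upperInfLaplacian_of_ne hgrad]
      exact h.neg_hess_le hcomp hf hu hU hΩU hφ hmax hgrad
        (exists_segment_of_mem hopen hx₀ (by simp [norm_smul, hgrad]))
  · have hfr : (x₀ : E d) ∈ frontier Ω := ⟨x₀.2, by rwa [hopen.interior_eq]⟩
    obtain ⟨e, r, γ, hchart⟩ := hC1 x₀ hfr
    have hν : IsOuterNormal Ω x₀ (‖∇ (graphFun e γ) (x₀ : E d)‖⁻¹ • ∇ (graphFun e γ) (x₀ : E d)) :=
      ⟨e, r, γ, hchart, rfl⟩
    set ν := ‖∇ (graphFun e γ) (x₀ : E d)‖⁻¹ • ∇ (graphFun e γ) (x₀ : E d)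
    -- Either the boundary alternative of the definition holds, or the gradient is non-zero and its
    -- opposite points into the domain, so the interior argument applies.
    rcases le_or_gt ⟪∇ φ (x₀ : E d), ν⟫ 0 with hle | hgt
    · exact Or.inr ⟨hfr, ν, hν, hle⟩
    · left
      have hgrad : ∇ φ (x₀ : E d) ≠ 0 := by
        intro h0
        rw [h0, inner_zero_left] at hgt
        exact lt_irrefl _ hgt
      rw [upperInfLaplacian_of_ne hgrad]
      refine h.neg_hess_le hcomp hf hu hU hΩU hφ hmax hgrad (exists_inward_segment hν ?_)
      rw [real_inner_smul_left]
      have : 0 < ‖∇ φ (x₀ : E d)‖ := norm_pos_iff.2 hgrad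
      positivity

end TugOfWar

end

theorem theorem1p6 (d : ℕ) (hd : 1 ≤ d) (Ω : Set (TugOfWar.E d)) (hopen : IsOpen Ω)
    (hconn : IsConnected Ω) (hbdd : Bornology.IsBounded Ω) (hC1 : TugOfWar.HasC1Boundary Ω) :
    ∃ L : ℝ → ℝ≥0, ∀ f : closure Ω → ℝ, Continuous f →
      TugOfWar.IsLimitAdvantage f 0 →
      ∃ u : closure Ω → ℝ, TugOfWar.IsViscositySolution Ω f u ∧
        LipschitzWith (L (⨆ x : closure Ω, |f x|)) u := by
  obtain ⟨L, hL⟩ := TugOfWar.exists_isGameLimit hopen hconn hbdd hC1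
  refine ⟨L, fun f hf hlim => ?_⟩
  obtain ⟨u, hu, h⟩ := hL f hf hlim
  have hcomp := hbdd.isCompact_closure
  exact ⟨u, ⟨h.isViscositySubsolution hd hopen hcomp hC1 hf hu.continuous,
    h.neg.isViscositySubsolution hd hopen hcomp hC1 hf.neg hu.continuous.neg⟩, hu⟩
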